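/- Let $M$ be a smooth finite-dimensional (Hausdorff) manifold with tangent bundle $TM$, let $T^\circ M\subset TM$ be the set of non-zero tangent vectors, and let $\Delta$ be the Liouville vector field on $TM$ (in natural coordinates $\Delta=\dot x^i\,\partial/\partial\dot x^i$). A spray is a vector field $S$, smooth on $T^\circ M$, that is a second-order differential equation field and satisfies $[\Delta,S]=S$ there. A geodesic of $S$ is a smooth curve $c:I\to M$ on an open interval $I$, with $\dot c(t)\neq0$ for all $t$, whose lift $\dot c$ is an integral curve of $S$. A Jacobi field along $c:I\to M$ is a vector field $J(t)=\frac{\partial\gamma}{\partial u}(0,t)$ along $c$, where $\gamma:\,]-\varepsilon,\varepsilon[\,\times I\to M$ is a smooth family of geodesics $\gamma(u,\cdot)$ of $S$ with $\gamma(0,\cdot)=c$. For $t_0\ne t_1$ in $I$, the points $c(t_0)$ and $c(t_1)$ (at the parameters $t_0,t_1$) are conjugate along $c$ with respect to $S$ if, on some open subinterval $I_1\subseteq I$ containing $t_0$ and $t_1$, there is a Jacobi field $J$ along $c|_{I_1}$ that is not identically zero and satisfies $J(t_0)=J(t_1)=0$. **Theorem.** Let $S$ and $\tilde S$ be projectively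 related sprays on $M$, i.e. $\tilde S=S-2P\Delta$ on $T^\circ M$ for a function $P$ that is smooth on $T^\circ M$ and satisfies $P(rv)=rP(v)$ for $r>0$. Let $c:I\to M$ be a geodesic of $S$. Then: 1. For every $t_0\in I$ there are an open interval $\tilde I\ni 0$ and a smooth surjective map $\theta:\tilde I\to I$ with $\theta'>0$ and $\theta(0)=t_0$ such that $\tilde c=c\circ\theta$ is a geodesic of $\tilde S$. 2. For every smooth surjective map $\theta:\tilde I\to I$ with $\theta'>0$ on an open interval $\tilde I$ such that $\tilde c=c\circ\theta$ is a geodesic of $\tilde S$, and for all $s_0,s_1\in\tilde I$: the points $c(\theta(s_0))$ and $c(\theta(s_1))$ are conjugate along $c$ with respect to $S$ if and only if the points $\tilde c(s_0)$ and $\tilde c(s_1)$ are conjugate along $\tilde c$ with respect to $\tilde S$. -/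

import Mathlib

open Set
open scoped Manifold ContDiff

noncomputable section

namespace SprayGeometry

section Definitions

variable {E : Type*} [NormedAddCommGroup E] [NormedSpace ℝ E]
  {M : Type*} [TopologicalSpace M] [ChartedSpace E M]

variable (E M) in
/-- The slit tangent bundle, i.e. the set of non-zero tangent vectors of `M`. -/
def slit : Set (TangentBundle 𝓘(ℝ, E) M) := {v | v.2 ≠ 0}

/-- The velocity `ċ(t)` of a curve `c` in `M`, as a point of the tangent bundle; the curve
`velocity c` is the lift of `c` to the tangent bundle. -/
def velocity (c : ℝ → M) (t : ℝ) : TangentBundle 𝓘(ℝ, E) M :=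
  ⟨c t, mfderiv 𝓘(ℝ, ℝ) 𝓘(ℝ, E) c t (1 : ℝ)⟩

section Fields

variable [IsManifold 𝓘(ℝ, E) ∞ M]

/-- The Liouville vector field `Δ` on the tangent bundle: its value at `v` is the velocity at
`r = 1` of the curve `r ↦ r • v` in the fibre through `v`. In natural coordinates
`Δ = ẋⁱ ∂/∂ẋⁱ`. -/
def liouville (v : TangentBundle 𝓘(ℝ, E) M) : TangentSpace 𝓘(ℝ, E).tangent v :=
  mfderiv 𝓘(ℝ, ℝ) 𝓘(ℝ, E).tangent
    (fun r : ℝ => (⟨v.1, r • v.2⟩ : TangentBundle 𝓘(ℝ, E) M)) 1 (1 : ℝ)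

/-- A vector field `S` on the tangent bundle is a spray if it is smooth on the slit tangent
bundle, it is a second-order field (`dτ ∘ S = id`, with `τ : TM → M` the projection, i.e. its
integral curves are lifts of curves in `M`), and `[Δ, S] = S`. As usual for sprays (for example
those of Finsler metrics), everything is required on the slit tangent bundle only; the values of
`S` on the zero section are never used. -/
structure IsSpray
    (S : (v : TangentBundle 𝓘(ℝ, E) M) → TangentSpace 𝓘(ℝ, E).tangent v) : Prop where
  smooth : ContMDiffOn 𝓘(ℝ, E).tangent 𝓘(ℝ, E).tangent.tangent ∞
    (fun v => (⟨v, S v⟩ : TangentBundle 𝓘(ℝ, E).tangent (TangentBundle 𝓘(ℝ, E) M)))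
    (slit E M)
  second_order : ∀ v ∈ slit E M,
    mfderiv 𝓘(ℝ, E).tangent 𝓘(ℝ, E)
      (fun w : TangentBundle 𝓘(ℝ, E) M => w.1) v (S v) = v.2
  bracket : ∀ v ∈ slit E M,
    VectorField.mlieBracket 𝓘(ℝ, E).tangent liouville S v = S v

/-- `S' = S - 2 P Δ` on the slit tangent bundle, for a function `P` that is smooth there and
positively homogeneous of degree one. -/
def ProjectivelyRelated
    (S S' : (v : TangentBundle 𝓘(ℝ, E) M) → TangentSpace 𝓘(ℝ, E).tangent v) : Prop :=
  ∃ P : TangentBundle 𝓘(ℝ, E) M → ℝ,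
    ContMDiffOn 𝓘(ℝ, E).tangent 𝓘(ℝ, ℝ) ∞ P (slit E M) ∧
    (∀ v ∈ slit E M, ∀ r : ℝ, 0 < r → P ⟨v.1, r • v.2⟩ = r * P v) ∧
    ∀ v ∈ slit E M, S' v = S v - (2 * P v) • liouville v

/-- `c` is, on the open interval `I`, a geodesic (base integral curve) of `S`: a smooth curve with
nowhere vanishing velocity whose lift is an integral curve of `S`. Values of `c` outside `I` are
irrelevant. -/
structure IsGeodesicOn
    (S : (v : TangentBundle 𝓘(ℝ, E) M) → TangentSpace 𝓘(ℝ, E).tangent v)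
    (c : ℝ → M) (I : Set ℝ) : Prop where
  smooth : ContMDiffOn 𝓘(ℝ, ℝ) 𝓘(ℝ, E) ∞ c I
  regular : ∀ t ∈ I, velocity c t ∈ slit E M
  integral : IsMIntegralCurveOn (I := 𝓘(ℝ, E).tangent) (velocity c) S I

/-- `J` is, on the open interval `I`, a Jacobi field along `c`: it is the variational vector field
`J(t) = ∂γ/∂u (0, t)` of a smooth one-parameter family `γ : ]-ε, ε[ × I → M` of geodesics of `S`
with `γ(0, t) = c(t)`. (The last condition below is an equality in the tangent bundle: it contains
`γ(0, t) = c(t)`.) -/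
def IsJacobiFieldOn
    (S : (v : TangentBundle 𝓘(ℝ, E) M) → TangentSpace 𝓘(ℝ, E).tangent v)
    (c : ℝ → M) (I : Set ℝ) (J : (t : ℝ) → TangentSpace 𝓘(ℝ, E) (c t)) : Prop :=
  ∃ ε : ℝ, 0 < ε ∧ ∃ γ : ℝ → ℝ → M,
    ContMDiffOn 𝓘(ℝ, ℝ × ℝ) 𝓘(ℝ, E) ∞ (fun p : ℝ × ℝ => γ p.1 p.2) (Ioo (-ε) ε ×ˢ I) ∧
    (∀ u ∈ Ioo (-ε) ε, IsGeodesicOn S (γ u) I) ∧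
    ∀ t ∈ I, velocity (fun u => γ u t) 0 = (⟨c t, J t⟩ : TangentBundle 𝓘(ℝ, E) M)

/-- The points `c(t₀)` and `c(t₁)` with `t₀ ≠ t₁` are conjugate along the geodesic `c : I → M`:
there is a Jacobi field along `c`, not identically zero, that vanishes at `t₀` and at `t₁`.

The Jacobi field is only asked to be defined on some open subinterval `I'` of `I` that contains
`t₀` and `t₁`: if `S` is incomplete, the geodesics close to `c` need not exist on all of `I`,
although they do on every compact part of it. Solutions of the linear Jacobi equation always
extend from `I'` to `I`, so that this does not depend on `I`. -/
def AreConjugate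
    (S : (v : TangentBundle 𝓘(ℝ, E) M) → TangentSpace 𝓘(ℝ, E).tangent v)
    (c : ℝ → M) (I : Set ℝ) (t₀ t₁ : ℝ) : Prop :=
  t₀ ≠ t₁ ∧ ∃ I' : Set ℝ, I' ⊆ I ∧ IsOpen I' ∧ I'.OrdConnected ∧ t₀ ∈ I' ∧ t₁ ∈ I' ∧
    ∃ J : (t : ℝ) → TangentSpace 𝓘(ℝ, E) (c t),
      IsJacobiFieldOn S c I' J ∧ J t₀ = 0 ∧ J t₁ = 0 ∧ ∃ t ∈ I', J t ≠ 0

end Fields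

end Definitions

/-- `θ` is a parameter transformation from the open interval `I'` onto `I`, smooth and with
strictly positive derivative. -/
structure IsReparametrization (θ : ℝ → ℝ) (I' I : Set ℝ) : Prop where
  isOpen : IsOpen I'
  ordConnected : I'.OrdConnected
  smooth : ContDiffOn ℝ ∞ θ I'
  deriv_pos : ∀ s ∈ I', 0 < deriv θ s
  image_eq : θ '' I' = I

end SprayGeometry

end

/-! In a chart of `TM` a spray has the form `(y, f(x, y))`, and `[Δ, S] = S` becomes Euler's
relation `∂_y f · y = 2 f`. Thus `f` is positively homogeneous of degree two in `y`, while
subtracting `2PΔ` replaces `f` by `f - 2 P y`. Hence, for a geodesic `c` of `S` and `θ' > 0`, the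
curve `c ∘ θ` is a geodesic of `S'` exactly when `θ'' = -2 P(ċ ∘ θ) θ'²`
(`IsSpray.deriv_deriv_comp_eq_force_iff`). The inverse `F` of `θ` then satisfies the linear equation
`F'' = 2 P(ċ) F'`, which two quadratures solve on all of `I`. This gives part 1.

For part 2, let `γ(u, ·)` be a family of geodesics of `S` whose variation field `J` vanishes at `t₀
= θ s₀` and `t₁ = θ s₁`. The linear equation along `γ(u, ·)` has an increasing solution `F(u, ·)`
with `F(u, t₀) = s₀` and `F(u, t₁) = s₁`, smooth in `u`; let `Θ(u, ·)` be its inverse. The curves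
`γ(u, Θ(u, ·))` are geodesics of `S'`. For `u = 0` uniqueness in the boundary value problem gives
`Θ(0, ·) = θ`. The new variation field is `J + ∂_uΘ · ċ`, and `∂_uΘ = 0` at `s₀` and `s₁`, so it
vanishes there.

It does not vanish identically (`exists_mem_slit_of_reparametrized_family`). Otherwise `J = g ċ`,
and the linearized geodesic equation together with Euler's relation gives `g'' = 0`. Two zeros force
`g = 0`, so `J` vanishes near `t₀`, hence everywhere by uniqueness for linear equations. The
converse implication is the same statement with `S`, `S'` exchanged, `P` negated and `θ` inverted.
-/

noncomputable section

namespace SprayGeometry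

/-! ### Sprays and the Liouville field in charts of the tangent bundle. -/

section Charts

open Filter Topology

variable {E : Type*} [NormedAddCommGroup E] [NormedSpace ℝ E]
  {M : Type*} [TopologicalSpace M] [ChartedSpace E M] [IsManifold 𝓘(ℝ, E) ∞ M]

/-- The chart of the tangent bundle induced by the preferred chart at `p`. -/
def tangentChart (p : M) : PartialEquiv (TangentBundle 𝓘(ℝ, E) M) (E × E) :=
  extChartAt 𝓘(ℝ, E).tangent (⟨p, 0⟩ : TangentBundle 𝓘(ℝ, E) M)

theorem mem_tangentChart_source {p : M} {v : TangentBundle 𝓘(ℝ, E) M} :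
    v ∈ (tangentChart p).source ↔ v.1 ∈ (chartAt E p).source := by
  rw [tangentChart, extChartAt_source, TangentBundle.mem_chart_source_iff]

theorem mem_tangentChart_target {p : M} {z : E × E} :
    z ∈ (tangentChart p).target ↔ z.1 ∈ (chartAt E p).target := by
  have := TangentBundle.mem_chart_target_iff (I := 𝓘(ℝ, E)) z (⟨p, 0⟩ : TangentBundle 𝓘(ℝ, E) M)
  refine Iff.trans ?_ this
  simp [tangentChart, ModelWithCorners.tangent, OpenPartialHomeomorph.extend, extChartAt]
  exact this

theorem tangentChart_apply {p : M} {v : TangentBundle 𝓘(ℝ, E) M}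
    (hv : v.1 ∈ (chartAt E p).source) :
    tangentChart p v = (extChartAt 𝓘(ℝ, E) p v.1,
      mfderiv 𝓘(ℝ, E) 𝓘(ℝ, E) (extChartAt 𝓘(ℝ, E) p) v.1 v.2) := by
  rw [← TangentBundle.continuousLinearMapAt_trivializationAt hv,
    TangentBundle.continuousLinearMapAt_trivializationAt_eq_core hv]
  rfl

theorem isOpen_tangentChart_source (p : M) :
    IsOpen (tangentChart (E := E) p).source := isOpen_extChartAt_source _

theorem isOpen_tangentChart_target (p : M) :
    IsOpen (tangentChart (E := E) p).target := isOpen_extChartAt_target _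

theorem contMDiffOn_tangentChart (p : M) :
    ContMDiffOn 𝓘(ℝ, E).tangent 𝓘(ℝ, E × E) ∞ (tangentChart (E := E) p) (tangentChart p).source := by
  rw [tangentChart, extChartAt_source]
  exact contMDiffOn_extChartAt

theorem contMDiffOn_tangentChart_symm (p : M) :
    ContMDiffOn 𝓘(ℝ, E × E) 𝓘(ℝ, E).tangent ∞ (tangentChart (E := E) p).symm (tangentChart p).target :=
  contMDiffOn_extChartAt_symm _

theorem isInvertible_mfderiv_tangentChart_symm {p : M} {z : E × E}
    (hz : z ∈ (tangentChart p).target) :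
    (mfderiv 𝓘(ℝ, E × E) 𝓘(ℝ, E).tangent (tangentChart p).symm z).IsInvertible := by
  have := isInvertible_mfderivWithin_extChartAt_symm (I := 𝓘(ℝ, E).tangent)
    (x := (⟨p, 0⟩ : TangentBundle 𝓘(ℝ, E) M)) hz
  rw [ModelWithCorners.range_eq_univ, mfderivWithin_univ] at this
  exact this

theorem isInvertible_mfderiv_tangentChart {p : M} {v : TangentBundle 𝓘(ℝ, E) M}
    (hv : v.1 ∈ (chartAt E p).source) :
    (mfderiv 𝓘(ℝ, E).tangent 𝓘(ℝ, E × E) (tangentChart p) v).IsInvertible :=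
  isInvertible_mfderiv_extChartAt (I := 𝓘(ℝ, E).tangent)
    (x := (⟨p, 0⟩ : TangentBundle 𝓘(ℝ, E) M)) (mem_tangentChart_source.2 hv)

theorem mdifferentiableAt_tangentChart {p : M} {v : TangentBundle 𝓘(ℝ, E) M}
    (hv : v.1 ∈ (chartAt E p).source) :
    MDifferentiableAt 𝓘(ℝ, E).tangent 𝓘(ℝ, E × E) (tangentChart p) v :=
  ((contMDiffOn_tangentChart p).contMDiffAt ((isOpen_tangentChart_source p).mem_nhds
    (mem_tangentChart_source.2 hv))).mdifferentiableAt (by simp)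

/-- A vector field on the tangent bundle, read in the chart induced by the preferred chart
at `p`. -/
def coordField (p : M) (S : (v : TangentBundle 𝓘(ℝ, E) M) → TangentSpace 𝓘(ℝ, E).tangent v)
    (z : E × E) : E × E :=
  VectorField.mpullback 𝓘(ℝ, E × E) 𝓘(ℝ, E).tangent (tangentChart p).symm S z

/-- Pulling back by the inverse chart is pushing forward by the chart, because the two derivatives
are mutually inverse. -/
theorem coordField_eq_mfderiv_symm {p : M}
    (S : (v : TangentBundle 𝓘(ℝ, E) M) → TangentSpace 𝓘(ℝ, E).tangent v)
    {z : E × E} (hz : z ∈ (tangentChart p).target) :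
    coordField p S z = mfderiv 𝓘(ℝ, E).tangent 𝓘(ℝ, E × E) (tangentChart p)
      ((tangentChart p).symm z) (S ((tangentChart p).symm z)) := by
  have h := mfderiv_extChartAt_comp_mfderivWithin_extChartAt_symm (I := 𝓘(ℝ, E).tangent)
    (x := (⟨p, 0⟩ : TangentBundle 𝓘(ℝ, E) M)) hz
  rw [ModelWithCorners.range_eq_univ, mfderivWithin_univ] at h
  obtain ⟨A, hA⟩ := isInvertible_mfderiv_tangentChart_symm hz
  unfold coordField
  rw [VectorField.mpullback_apply, ← hA, ContinuousLinearMap.inverse_equiv]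
  have h' := DFunLike.congr_fun h (A.symm (S ((tangentChart p).symm z)))
  change (mfderiv 𝓘(ℝ, E).tangent 𝓘(ℝ, E × E) (tangentChart p) ((tangentChart p).symm z))
    ((mfderiv 𝓘(ℝ, E × E) 𝓘(ℝ, E).tangent (tangentChart p).symm z) _) = _ at h'
  rw [← hA] at h'
  erw [A.apply_symm_apply] at h'
  exact h'.symm

theorem coordField_eq_mfderiv {p : M}
    (S : (v : TangentBundle 𝓘(ℝ, E) M) → TangentSpace 𝓘(ℝ, E).tangent v)
    {v : TangentBundle 𝓘(ℝ, E) M} (hv : v.1 ∈ (chartAt E p).source) :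
    coordField p S (tangentChart p v) =
      mfderiv 𝓘(ℝ, E).tangent 𝓘(ℝ, E × E) (tangentChart p) v (S v) := by
  have hl : (tangentChart p).symm (tangentChart p v) = v :=
    (tangentChart p).left_inv (mem_tangentChart_source.2 hv)
  -- The tangent space depends on the base point, so the equality of points is used by substitution,
  -- with values compared in `E × E`.
  have key : ∀ w, w = v → (mfderiv 𝓘(ℝ, E).tangent 𝓘(ℝ, E × E) (tangentChart p) w (S w) : E × E) =
      mfderiv 𝓘(ℝ, E).tangent 𝓘(ℝ, E × E) (tangentChart p) v (S v) := by
    rintro w rfl; rfl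
  rw [coordField_eq_mfderiv_symm S
    ((tangentChart p).map_source (mem_tangentChart_source.2 hv))]
  exact key _ hl

theorem mem_slit_iff {p : M} {v : TangentBundle 𝓘(ℝ, E) M} (hv : v.1 ∈ (chartAt E p).source) :
    v ∈ slit E M ↔ (tangentChart p v).2 ≠ 0 := by
  rw [tangentChart_apply hv]
  obtain ⟨A, hA⟩ := isInvertible_mfderiv_extChartAt (I := 𝓘(ℝ, E)) (x := p) (y := v.1)
    (by rwa [extChartAt_source])
  rw [← hA]
  exact not_congr A.map_eq_zero_iff.symm

theorem tangentChart_smul {p : M} {v : TangentBundle 𝓘(ℝ, E) M}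
    (hv : v.1 ∈ (chartAt E p).source) (r : ℝ) :
    tangentChart p (⟨v.1, r • v.2⟩ : TangentBundle 𝓘(ℝ, E) M) =
      ((tangentChart p v).1, r • (tangentChart p v).2) := by
  rw [tangentChart_apply hv, 
    tangentChart_apply (v := (⟨v.1, r • v.2⟩ : TangentBundle 𝓘(ℝ, E) M)) hv]
  exact Prod.ext rfl (map_smul (mfderiv 𝓘(ℝ, E) 𝓘(ℝ, E) (extChartAt 𝓘(ℝ, E) p) v.1) r v.2)

theorem isOpen_slit : IsOpen (slit E M) := by
  rw [isOpen_iff_mem_nhds]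
  intro v hv
  have hs := mem_chart_source E v.1
  have h1 : ContinuousAt (tangentChart v.1) v := (mdifferentiableAt_tangentChart hs).continuousAt
  filter_upwards [(isOpen_tangentChart_source v.1).mem_nhds (mem_tangentChart_source.2 hs),
    (continuous_snd.continuousAt.comp h1).eventually_ne ((mem_slit_iff hs).1 hv)] with w hw hw'
  exact (mem_slit_iff (mem_tangentChart_source.1 hw)).2 hw'

/-- The chart is linear on fibres, so it sends the curve `r ↦ r • v` to `r ↦ (x, r • y)`, whose
velocity at `r = 1` is `(0, y)`. -/
theorem mfderiv_tangentChart_liouville {p : M} {v : TangentBundle 𝓘(ℝ, E) M}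
    (hv : v.1 ∈ (chartAt E p).source) :
    (mfderiv 𝓘(ℝ, E).tangent 𝓘(ℝ, E × E) (tangentChart p) v (liouville v) : E × E) =
      (0, (tangentChart p v).2) := by
  set γ : ℝ → TangentBundle 𝓘(ℝ, E) M := fun r => ⟨v.1, r • v.2⟩ with hγ
  have hγ1 : γ 1 = v := by simp [hγ]
  have hc : ∀ r, tangentChart p (γ r) = ((tangentChart p v).1, r • (tangentChart p v).2) :=
    fun r => tangentChart_smul hv r
  have hsm : MDifferentiableAt 𝓘(ℝ, ℝ) 𝓘(ℝ, E).tangent γ 1 := by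
    have h1 : γ = fun r => (tangentChart p).symm ((tangentChart p v).1, r • (tangentChart p v).2) := by
      funext r
      rw [← hc r]
      exact ((tangentChart p).left_inv (x := γ r) (mem_tangentChart_source.2 hv)).symm
    have h2 : ((tangentChart p v).1, (1 : ℝ) • (tangentChart p v).2) ∈ (tangentChart p).target := by
      rw [← hc 1]; exact (tangentChart p).map_source (mem_tangentChart_source.2 hv)
    rw [h1]
    refine MDifferentiableAt.comp (I' := 𝓘(ℝ, E × E)) 1 (((contMDiffOn_tangentChart_symm p).contMDiffAt
      ((isOpen_tangentChart_target p).mem_nhds h2)).mdifferentiableAt (by simp)) ?_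
    apply DifferentiableAt.mdifferentiableAt
    fun_prop
  have hd : HasDerivAt (fun r : ℝ => ((tangentChart p v).1, r • (tangentChart p v).2))
      ((0 : E), (tangentChart p v).2) 1 := by
    simpa using (hasDerivAt_const (1 : ℝ) (tangentChart p v).1).prodMk
      ((hasDerivAt_id (1 : ℝ)).smul_const (tangentChart p v).2)
  have hcomp := mfderiv_comp_apply (I' := 𝓘(ℝ, E).tangent) (I'' := 𝓘(ℝ, E × E)) (1 : ℝ)
    (g := tangentChart p) (f := γ) (mdifferentiableAt_tangentChart (by exact hv)) hsm (1 : ℝ)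
  have e1 : (tangentChart p ∘ γ) = fun r => ((tangentChart p v).1, r • (tangentChart p v).2) :=
    funext hc
  have key : ∀ w, w = v → ∀ X : E × E,
      (mfderiv 𝓘(ℝ, E).tangent 𝓘(ℝ, E × E) (tangentChart p) w X : E × E) =
      mfderiv 𝓘(ℝ, E).tangent 𝓘(ℝ, E × E) (tangentChart p) v X := by
    rintro w rfl X; rfl
  unfold liouville
  refine (key _ hγ1 _).symm.trans (hcomp.symm.trans ?_)
  rw [e1, mfderiv_eq_fderiv]
  exact hd.deriv

theorem coordField_liouville {p : M} {z : E × E} (hz : z ∈ (tangentChart p).target) :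
    coordField p liouville z = (0, z.2) := by
  have h := (tangentChart p).map_target hz
  rw [mem_tangentChart_source] at h
  rw [coordField_eq_mfderiv_symm _ hz]
  have := mfderiv_tangentChart_liouville h
  rw [(tangentChart p).right_inv hz] at this
  exact this

variable {S S' : (v : TangentBundle 𝓘(ℝ, E) M) → TangentSpace 𝓘(ℝ, E).tangent v}

/-- In these charts the projection `TM → M` is `Prod.fst`, so `dτ ∘ S = id` fixes the first
component. -/
theorem IsSpray.coordField_fst (hS : IsSpray S) {p : M} {z : E × E}
    (hz : z ∈ (tangentChart p).target) (hz0 : z.2 ≠ 0) : (coordField p S z).1 = z.2 := by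
  have h := (tangentChart p).map_target hz
  have h' := h
  rw [mem_tangentChart_source] at h
  set v := (tangentChart p).symm z with hv
  have hvz : tangentChart p v = z := (tangentChart p).right_inv hz
  have hsl : v ∈ slit E M := by rw [mem_slit_iff h, hvz]; exact hz0
  have h1 := hS.second_order v hsl
  have hφ := mdifferentiableAt_extChartAt (I := 𝓘(ℝ, E)) h
  have hπ : MDifferentiableAt 𝓘(ℝ, E).tangent 𝓘(ℝ, E)
      (fun w : TangentBundle 𝓘(ℝ, E) M => w.1) v :=
    (Bundle.contMDiff_proj (n := ∞) (TangentSpace 𝓘(ℝ, E))).mdifferentiable (by simp) v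
  have e1 := mfderiv_comp_apply v hφ hπ (S v)
  have e2 := mfderiv_comp_apply (I'' := 𝓘(ℝ, E)) v (g := (Prod.fst : E × E → E))
    (differentiableAt_fst.mdifferentiableAt) (mdifferentiableAt_tangentChart h) (S v)
  rw [h1] at e1
  rw [coordField_eq_mfderiv_symm _ hz]
  -- The maps `extChartAt ∘ proj` and `Prod.fst ∘ tangentChart` agree by definition, so the two
  -- chain rules compute the same vector.
  have e5 : (mfderiv 𝓘(ℝ, E) 𝓘(ℝ, E) (extChartAt 𝓘(ℝ, E) p) v.1 v.2 : E) = _ := e1.symm.trans e2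
  rw [mfderiv_eq_fderiv, fderiv_fst] at e5
  have e4 := congrArg Prod.snd (tangentChart_apply h)
  rw [hvz] at e4
  rw [e4]
  exact e5.symm

end Charts

/-! ### Smoothness and homogeneity of a spray in coordinates. -/

section CoordinateForm

open Filter Topology

variable {E : Type*} [NormedAddCommGroup E] [NormedSpace ℝ E] [FiniteDimensional ℝ E]
  {M : Type*} [TopologicalSpace M] [ChartedSpace E M] [IsManifold 𝓘(ℝ, E) ∞ M]
  {S S' : (v : TangentBundle 𝓘(ℝ, E) M) → TangentSpace 𝓘(ℝ, E).tangent v}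

theorem IsSpray.contDiffAt_coordField (hS : IsSpray S) {p : M} {z : E × E}
    (hz : z ∈ (tangentChart p).target) (hz0 : z.2 ≠ 0) : ContDiffAt ℝ ∞ (coordField p S) z := by
  have : CompleteSpace E := FiniteDimensional.complete ℝ E
  have h := (tangentChart p).map_target hz
  rw [mem_tangentChart_source] at h
  have hsl : (tangentChart p).symm z ∈ slit E M := by
    rw [mem_slit_iff h, (tangentChart p).right_inv hz]; exact hz0
  have hsm := hS.smooth.contMDiffAt (isOpen_slit.mem_nhds hsl)
  have hf := (contMDiffOn_tangentChart_symm p).contMDiffAt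
    ((isOpen_tangentChart_target p).mem_nhds hz)
  have := ContMDiffAt.mpullback_vectorField_preimage hsm hf
    (isInvertible_mfderiv_tangentChart_symm hz) le_rfl
  exact contMDiffAt_vectorSpace_iff_contDiffAt.1 this

/-- Near `v` the Liouville field is the pullback of the linear field `(x, y) ↦ (0, y)` by a chart.
-/
theorem mdifferentiableAt_liouville (v : TangentBundle 𝓘(ℝ, E) M) :
    MDifferentiableAt 𝓘(ℝ, E).tangent 𝓘(ℝ, E).tangent.tangent
      (fun w => (⟨w, liouville w⟩ : TangentBundle 𝓘(ℝ, E).tangent (TangentBundle 𝓘(ℝ, E) M)))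
      v := by
  have : CompleteSpace E := FiniteDimensional.complete ℝ E
  have hs := mem_tangentChart_source.2 (mem_chart_source E v.1)
  have hc : ContMDiffAt 𝓘(ℝ, E).tangent 𝓘(ℝ, E × E) ∞ (tangentChart v.1) v :=
    (contMDiffOn_tangentChart v.1).contMDiffAt ((isOpen_tangentChart_source v.1).mem_nhds hs)
  let V : (z : E × E) → TangentSpace 𝓘(ℝ, E × E) z := fun z => ((0 : E), z.2)
  have hV : ContMDiffAt 𝓘(ℝ, E × E) 𝓘(ℝ, E × E).tangent ∞
      (fun z => (⟨z, V z⟩ : TangentBundle 𝓘(ℝ, E × E) (E × E))) (tangentChart v.1 v) :=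
    contMDiffAt_vectorSpace_iff_contDiffAt.2 (by unfold V; fun_prop)
  have := (hV.mpullback_vectorField_preimage hc
    (isInvertible_mfderiv_tangentChart (mem_chart_source E v.1)) le_rfl).mdifferentiableAt (by simp)
  refine this.congr_of_eventuallyEq ?_
  filter_upwards [(isOpen_tangentChart_source v.1).mem_nhds hs] with w hw
  rw [mem_tangentChart_source] at hw
  congr 1
  obtain ⟨A, hA⟩ := isInvertible_mfderiv_tangentChart hw
  rw [VectorField.mpullback_apply, ← hA, ContinuousLinearMap.inverse_equiv]
  have h2 := mfderiv_tangentChart_liouville hw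
  rw [← hA] at h2
  exact ((A.symm_apply_eq).2 h2.symm).symm

/-- Euler's relation of degree two. With `Δ = (0, y)` the second component of `[Δ, S]` is `∂_y S₂ ·
y - S₂`, and the bracket condition equates it with `S₂`. Brackets commute with pullback by the
inverse chart. -/
theorem IsSpray.fderiv_coordField_snd (hS : IsSpray S) {p : M} {z : E × E}
    (hz : z ∈ (tangentChart p).target) (hz0 : z.2 ≠ 0) :
    fderiv ℝ (fun w => (coordField p S w).2) z (0, z.2) = (2 : ℝ) • (coordField p S z).2 := by
  have : CompleteSpace E := FiniteDimensional.complete ℝ E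
  have h := (tangentChart p).map_target hz
  rw [mem_tangentChart_source] at h
  have hsl : (tangentChart p).symm z ∈ slit E M := by
    rw [mem_slit_iff h, (tangentChart p).right_inv hz]; exact hz0
  have : IsManifold 𝓘(ℝ, E).tangent (minSmoothness ℝ 2) (TangentBundle 𝓘(ℝ, E) M) := by
    rw [minSmoothness_of_isRCLikeNormedField]
    exact IsManifold.of_le (n := ∞) ENat.LEInfty.out
  have hb := VectorField.mpullback_mlieBracket (I := 𝓘(ℝ, E × E)) (n := ∞)
    (mdifferentiableAt_liouville ((tangentChart p).symm z))
    ((hS.smooth.contMDiffAt (isOpen_slit.mem_nhds hsl)).mdifferentiableAt (by simp))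
    ((contMDiffOn_tangentChart_symm p).contMDiffAt
      ((isOpen_tangentChart_target p).mem_nhds hz)) (by
        rw [minSmoothness_of_isRCLikeNormedField]
        exact ENat.LEInfty.out)
  rw [VectorField.mpullback_apply, hS.bracket _ hsl, ← VectorField.mlieBracketWithin_univ,
    VectorField.mlieBracketWithin_eq_lieBracketWithin] at hb
  have hb' : coordField p S z =
      VectorField.lieBracketWithin ℝ (coordField p liouville) (coordField p S) univ z := hb
  rw [VectorField.lieBracketWithin_univ] at hb'
  have hl : coordField p liouville =ᶠ[𝓝 z] fun w : E × E => ((0 : E), w.2) := by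
    filter_upwards [(isOpen_tangentChart_target p).mem_nhds hz] with w hw
    exact coordField_liouville hw
  have hl' : HasFDerivAt (fun w : E × E => ((0 : E), w.2))
      ((0 : E × E →L[ℝ] E).prod (ContinuousLinearMap.snd ℝ E E)) z :=
    (hasFDerivAt_const _ _).prodMk hasFDerivAt_snd
  rw [VectorField.lieBracket, hl.fderiv_eq, hl'.fderiv, coordField_liouville hz] at hb'
  have hd := (hS.contDiffAt_coordField hz hz0).differentiableAt (by simp)
  have h2 : fderiv ℝ (fun w => (coordField p S w).2) z =
      (ContinuousLinearMap.snd ℝ E E).comp (fderiv ℝ (coordField p S) z) :=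
    ((ContinuousLinearMap.snd ℝ E E).hasFDerivAt.comp z hd.hasFDerivAt).fderiv
  have h3 := congrArg Prod.snd hb'
  rw [h2, two_smul]
  simp at h3 ⊢
  exact (eq_sub_iff_add_eq.1 h3).symm

/-- By Euler's relation `r⁻² S₂(x, r y)` has zero derivative on `r > 0`, so it equals its value at
`r = 1`. -/
theorem IsSpray.coordField_smul_snd (hS : IsSpray S) {p : M} {x y : E}
    (hx : x ∈ (chartAt E p).target) (hy : y ≠ 0) {r : ℝ} (hr : 0 < r) :
    (coordField p S (x, r • y)).2 = r ^ 2 • (coordField p S (x, y)).2 := by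
  let g : ℝ → E := fun r => (r ^ 2)⁻¹ • (coordField p S (x, r • y)).2
  have hg : ∀ r ∈ Ioi (0 : ℝ), HasDerivAt g 0 r := by
    intro r hr
    rw [mem_Ioi] at hr
    have hm : ((x, r • y) : E × E) ∈ (tangentChart p).target := mem_tangentChart_target.2 hx
    have hm0 : ((x, r • y) : E × E).2 ≠ 0 := smul_ne_zero hr.ne' hy
    have hF := (((hS.contDiffAt_coordField hm hm0).differentiableAt (by simp)).snd).hasFDerivAt
    have hc : HasDerivAt (fun r : ℝ => ((x, r • y) : E × E)) ((0 : E), y) r := by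
      simpa using (hasDerivAt_const r x).prodMk ((hasDerivAt_id r).smul_const y)
    have h1 := hF.comp_hasDerivAt r hc
    have h2 := hS.fderiv_coordField_snd hm hm0
    have h3 : ((0 : E), ((x, r • y) : E × E).2) = r • ((0 : E), y) := by simp
    rw [h3, map_smul] at h2
    have h4 : fderiv ℝ (fun w => (coordField p S w).2) (x, r • y) ((0 : E), y) =
        (2 * r⁻¹) • (coordField p S (x, r • y)).2 := by
      rw [mul_comm, mul_smul, ← h2, smul_smul, inv_mul_cancel₀ hr.ne', one_smul]
    rw [h4] at h1
    have h5 := ((hasDerivAt_pow 2 r).inv (pow_ne_zero 2 hr.ne')).smul h1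
    refine h5.congr_deriv ?_
    rw [smul_smul]
    simp only [Function.comp, ← add_smul]
    convert zero_smul ℝ _ using 2
    simp; field_simp; ring
  have h := (convex_Ioi (0 : ℝ)).is_const_of_fderivWithin_eq_zero (𝕜 := ℝ) (f := g)
    (fun r hr => (hg r hr).differentiableAt.differentiableWithinAt) (fun r hr => by
      rw [fderivWithin_of_isOpen isOpen_Ioi hr]
      ext; simp [(hg r hr).deriv]) (mem_Ioi.2 hr) (mem_Ioi.2 one_pos)
  simp only [g, one_smul] at h
  rw [inv_smul_eq_iff₀ (pow_ne_zero 2 hr.ne')] at h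
  simpa using h

end CoordinateForm

/-! ### The geodesic equation `x'' = f(x, x')`. -/

section GeodesicEquation

open Filter Topology

variable {E : Type*} [NormedAddCommGroup E] [NormedSpace ℝ E]
  {M : Type*} [TopologicalSpace M] [ChartedSpace E M] [IsManifold 𝓘(ℝ, E) ∞ M]
  {S S' : (v : TangentBundle 𝓘(ℝ, E) M) → TangentSpace 𝓘(ℝ, E).tangent v}

/-- The right-hand side of the geodesic equation `x'' = force (x, x')` of the second-order field `S`
in the preferred chart at `p`. -/
def force (p : M) (S : (v : TangentBundle 𝓘(ℝ, E) M) → TangentSpace 𝓘(ℝ, E).tangent v)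
    (z : E × E) : E := (coordField p S z).2

theorem IsSpray.contDiffAt_force [FiniteDimensional ℝ E] (hS : IsSpray S) {p : M} {z : E × E}
    (hz : z.1 ∈ (chartAt E p).target) (hz0 : z.2 ≠ 0) : ContDiffAt ℝ ∞ (force p S) z :=
  (hS.contDiffAt_coordField (mem_tangentChart_target.2 hz) hz0).snd

theorem IsSpray.fderiv_force [FiniteDimensional ℝ E] (hS : IsSpray S) {p : M} {z : E × E}
    (hz : z.1 ∈ (chartAt E p).target) (hz0 : z.2 ≠ 0) :
    fderiv ℝ (force p S) z (0, z.2) = (2 : ℝ) • force p S z :=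
  hS.fderiv_coordField_snd (mem_tangentChart_target.2 hz) hz0

theorem IsSpray.force_smul [FiniteDimensional ℝ E] (hS : IsSpray S) {p : M} {x y : E}
    (hx : x ∈ (chartAt E p).target) (hy : y ≠ 0) {r : ℝ} (hr : 0 < r) :
    force p S (x, r • y) = r ^ 2 • force p S (x, y) :=
  hS.coordField_smul_snd hx hy hr

theorem force_tangentChart_sub_smul {P : TangentBundle 𝓘(ℝ, E) M → ℝ} {p : M}
    {v : TangentBundle 𝓘(ℝ, E) M} (hv : v.1 ∈ (chartAt E p).source)
    (h : S' v = S v - (2 * P v) • liouville v) :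
    force p S' (tangentChart p v) =
      force p S (tangentChart p v) - (2 * P v) • (tangentChart p v).2 := by
  unfold force
  rw [coordField_eq_mfderiv _ hv, coordField_eq_mfderiv _ hv, h]
  have h1 := mfderiv_tangentChart_liouville hv
  have h2 : (mfderiv 𝓘(ℝ, E).tangent 𝓘(ℝ, E × E) (tangentChart p) v
      (S v - (2 * P v) • liouville v) : E × E) =
      (mfderiv 𝓘(ℝ, E).tangent 𝓘(ℝ, E × E) (tangentChart p) v (S v) : E × E) - (2 * P v) •
      (mfderiv 𝓘(ℝ, E).tangent 𝓘(ℝ, E × E) (tangentChart p) v (liouville v) : E × E) := by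
    rw [map_sub, map_smul]
  rw [h2, h1]
  rfl

theorem tangentChart_velocity {c : ℝ → M} {t : ℝ} (hc : MDifferentiableAt 𝓘(ℝ, ℝ) 𝓘(ℝ, E) c t)
    {p : M} (hp : c t ∈ (chartAt E p).source) :
    tangentChart p (velocity c t : TangentBundle 𝓘(ℝ, E) M) =
      (extChartAt 𝓘(ℝ, E) p (c t), deriv (fun τ => extChartAt 𝓘(ℝ, E) p (c τ)) t) := by
  rw [tangentChart_apply (v := velocity c t) hp]
  refine Prod.ext rfl ?_
  have h := mfderiv_comp_apply t (mdifferentiableAt_extChartAt (I := 𝓘(ℝ, E)) hp) hc (1 : ℝ)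
  rw [mfderiv_eq_fderiv] at h
  exact h.symm

theorem contDiffAt_coordCurve {c : ℝ → M} {t : ℝ} (hc : ContMDiffAt 𝓘(ℝ, ℝ) 𝓘(ℝ, E) ∞ c t)
    {p : M} (hp : c t ∈ (chartAt E p).source) :
    ContDiffAt ℝ ∞ (fun τ => extChartAt 𝓘(ℝ, E) p (c τ)) t :=
  ((contMDiffAt_extChartAt' hp).comp t hc).contDiffAt

theorem _root_.ContDiffAt.deriv_of_infty {F : Type*} [NormedAddCommGroup F] [NormedSpace ℝ F]
    {f : ℝ → F} {t : ℝ} (hf : ContDiffAt ℝ ∞ f t) : ContDiffAt ℝ ∞ (deriv f) t :=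
  (hf.fderiv_right (m := ∞) le_rfl).clm_apply contDiffAt_const

theorem _root_.HasMFDerivAt.hasDerivAt_apply_one {F : Type*} [NormedAddCommGroup F]
    [NormedSpace ℝ F] {f : ℝ → F} {t : ℝ} {L : ℝ →L[ℝ] F}
    (h : HasMFDerivAt 𝓘(ℝ, ℝ) 𝓘(ℝ, F) f t L) : HasDerivAt f (L 1) t :=
  have h' : HasFDerivAt f L t := hasMFDerivAt_iff_hasFDerivAt.1 h
  h'.hasDerivAt

/-- The lift of `c` reads `(x, x')` in the chart, and the derivative of the chart is invertible, so
the integral curve condition can be tested in coordinates. -/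
theorem hasMFDerivAt_velocity_iff {c : ℝ → M} {t : ℝ}
    (hc : ContMDiffAt 𝓘(ℝ, ℝ) 𝓘(ℝ, E) ∞ c t) {p : M} (hp : c t ∈ (chartAt E p).source) :
    HasMFDerivAt 𝓘(ℝ, ℝ) 𝓘(ℝ, E).tangent (velocity c) t
        ((1 : ℝ →L[ℝ] ℝ).smulRight (S (velocity c t))) ↔
      HasDerivAt (fun τ => (extChartAt 𝓘(ℝ, E) p (c τ),
          deriv (fun τ => extChartAt 𝓘(ℝ, E) p (c τ)) τ))
        (coordField p S (tangentChart p (velocity c t))) t := by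
  set x : ℝ → E := fun τ => extChartAt 𝓘(ℝ, E) p (c τ) with hx
  have hev : ∀ᶠ τ in 𝓝 t, tangentChart p (velocity c τ : TangentBundle 𝓘(ℝ, E) M) =
      (x τ, deriv x τ) ∧ c τ ∈ (chartAt E p).source := by
    have h2 : ∀ᶠ τ in 𝓝 t, ContMDiffAt 𝓘(ℝ, ℝ) 𝓘(ℝ, E) 1 c τ :=
      (contMDiffAt_iff_contMDiffAt_nhds (by simp)).1 (hc.of_le ENat.LEInfty.out)
    filter_upwards [hc.continuousAt.preimage_mem_nhds ((chartAt E p).open_source.mem_nhds hp), h2]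
      with τ h1 h2
    exact ⟨tangentChart_velocity (h2.mdifferentiableAt (by simp)) h1, h1⟩
  have hcomp : (tangentChart p ∘ (velocity c : ℝ → TangentBundle 𝓘(ℝ, E) M)) =ᶠ[𝓝 t]
      fun τ => (x τ, deriv x τ) := hev.mono fun τ h => h.1
  have hp' : (velocity c t : TangentBundle 𝓘(ℝ, E) M).1 ∈ (chartAt E p).source := hp
  have hΦ := (mdifferentiableAt_tangentChart hp').hasMFDerivAt
  have hxs := contDiffAt_coordCurve hc hp
  have hxd : DifferentiableAt ℝ (fun τ => (x τ, deriv x τ)) t :=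
    (hxs.differentiableAt (by simp)).prodMk (hxs.deriv_of_infty.differentiableAt (by simp))
  rw [coordField_eq_mfderiv S hp']
  constructor
  · intro h
    have h1 := (hΦ.comp t h).congr_of_eventuallyEq hcomp.symm
    refine (HasMFDerivAt.hasDerivAt_apply_one h1).congr_deriv ?_
    change mfderiv 𝓘(ℝ, E).tangent 𝓘(ℝ, E × E) (tangentChart p) (velocity c t) ((1 : ℝ) • _) = _
    rw [one_smul]
  · intro h
    -- Differentiability of the lift itself has to be established first: near `t` it is the inverse
    -- chart applied to the smooth curve `(x, x')`.
    have hv : (velocity c : ℝ → TangentBundle 𝓘(ℝ, E) M) =ᶠ[𝓝 t]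
        (tangentChart p).symm ∘ fun τ => (x τ, deriv x τ) := by
      filter_upwards [hev] with τ hτ
      rw [Function.comp, ← hτ.1]
      exact ((tangentChart p).left_inv (mem_tangentChart_source.2 hτ.2)).symm
    have ht : (x t, deriv x t) ∈ (tangentChart (E := E) p).target := by
      rw [← hev.self_of_nhds.1]
      exact (tangentChart p).map_source (mem_tangentChart_source.2 hp')
    have hvd : MDifferentiableAt 𝓘(ℝ, ℝ) 𝓘(ℝ, E).tangent
        (velocity c : ℝ → TangentBundle 𝓘(ℝ, E) M) t := by
      refine MDifferentiableAt.congr_of_eventuallyEq ?_ hv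
      exact MDifferentiableAt.comp (I' := 𝓘(ℝ, E × E)) t
        (((contMDiffOn_tangentChart_symm p).contMDiffAt
        ((isOpen_tangentChart_target p).mem_nhds ht)).mdifferentiableAt (by simp))
        hxd.mdifferentiableAt
    have h1 := (hΦ.comp t hvd.hasMFDerivAt).congr_of_eventuallyEq hcomp.symm
    have h2 := (HasMFDerivAt.hasDerivAt_apply_one h1).unique h
    obtain ⟨A, hA⟩ := isInvertible_mfderiv_tangentChart hp'
    have h3 : mfderiv 𝓘(ℝ, ℝ) 𝓘(ℝ, E).tangent
        (velocity c : ℝ → TangentBundle 𝓘(ℝ, E) M) t (1 : ℝ) = S (velocity c t) := by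
      apply A.injective
      have h4 : (mfderiv 𝓘(ℝ, E).tangent 𝓘(ℝ, E × E) (tangentChart p) (velocity c t)
        (mfderiv 𝓘(ℝ, ℝ) 𝓘(ℝ, E).tangent (velocity c : ℝ → TangentBundle 𝓘(ℝ, E) M) t (1 : ℝ)) :
          E × E) = _ := h2
      rw [← hA] at h4
      exact h4
    -- A linear map on `ℝ` is determined by its value at `1`.
    have h5 : mfderiv 𝓘(ℝ, ℝ) 𝓘(ℝ, E).tangent (velocity c : ℝ → TangentBundle 𝓘(ℝ, E) M) t =
        (1 : ℝ →L[ℝ] ℝ).smulRight (S (velocity c t)) := by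
      refine ContinuousLinearMap.ext fun (r : ℝ) => ?_
      have h6 := (mfderiv 𝓘(ℝ, ℝ) 𝓘(ℝ, E).tangent
        (velocity c : ℝ → TangentBundle 𝓘(ℝ, E) M) t).map_smul r (1 : ℝ)
      rw [h3] at h6
      refine Eq.trans ?_ h6
      congr 1
      exact (mul_one r).symm
    rw [← h5]
    exact hvd.hasMFDerivAt

/-- For a second-order field the first component of the equation for `(x, x')` holds automatically,
and only the second is a condition. -/
theorem IsSpray.hasMFDerivAt_velocity_iff (hS : IsSpray S) {c : ℝ → M} {t : ℝ}
    (hc : ContMDiffAt 𝓘(ℝ, ℝ) 𝓘(ℝ, E) ∞ c t) {p : M} (hp : c t ∈ (chartAt E p).source)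
    (h0 : velocity c t ∈ slit E M) :
    HasMFDerivAt 𝓘(ℝ, ℝ) 𝓘(ℝ, E).tangent (velocity c) t
        ((1 : ℝ →L[ℝ] ℝ).smulRight (S (velocity c t))) ↔
      deriv (deriv fun τ => extChartAt 𝓘(ℝ, E) p (c τ)) t =
        force p S (tangentChart p (velocity c t)) := by
  have hp' : (velocity c t : TangentBundle 𝓘(ℝ, E) M).1 ∈ (chartAt E p).source := hp
  have hm := (tangentChart p).map_source (mem_tangentChart_source.2 hp')
  have h1 := hS.coordField_fst hm ((mem_slit_iff hp').1 h0)
  have hv := tangentChart_velocity (hc.mdifferentiableAt (by simp)) hp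
  have hxs := contDiffAt_coordCurve hc hp
  have hd := (hxs.differentiableAt (by simp)).hasDerivAt.prodMk
    (hxs.deriv_of_infty.differentiableAt (by simp)).hasDerivAt
  rw [SprayGeometry.hasMFDerivAt_velocity_iff hc hp]
  constructor
  · intro h
    exact congrArg Prod.snd (hd.unique h)
  · intro h
    refine hd.congr_deriv (Prod.ext ?_ h)
    rw [h1, hv]

theorem IsGeodesicOn.deriv_deriv_eq (hS : IsSpray S) {c : ℝ → M} {I : Set ℝ} (hI : IsOpen I)
    (hc : IsGeodesicOn S c I) {t : ℝ} (ht : t ∈ I) {p : M} (hp : c t ∈ (chartAt E p).source) :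
    deriv (deriv fun τ => extChartAt 𝓘(ℝ, E) p (c τ)) t =
      force p S (tangentChart p (velocity c t)) :=
  (hS.hasMFDerivAt_velocity_iff (hc.smooth.contMDiffAt (hI.mem_nhds ht)) hp (hc.regular t ht)).1
    ((hc.integral t ht).hasMFDerivAt (hI.mem_nhds ht))

theorem IsSpray.isGeodesicOn (hS : IsSpray S) {c : ℝ → M} {I : Set ℝ} (hI : IsOpen I)
    (hc : ContMDiffOn 𝓘(ℝ, ℝ) 𝓘(ℝ, E) ∞ c I) (h0 : ∀ t ∈ I, velocity c t ∈ slit E M)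
    (h : ∀ t ∈ I, deriv (deriv fun τ => extChartAt 𝓘(ℝ, E) (c t) (c τ)) t =
      force (c t) S (tangentChart (c t) (velocity c t))) : IsGeodesicOn S c I where
  smooth := hc
  regular := h0
  integral t ht := ((hS.hasMFDerivAt_velocity_iff (hc.contMDiffAt (hI.mem_nhds ht))
    (mem_chart_source E _) (h0 t ht)).2 (h t ht)).hasMFDerivWithinAt

end GeodesicEquation

/-! ### Reparametrized geodesics and the equation for the parameter change. -/

section Reparametrization

open Filter Topology

variable {E : Type*} [NormedAddCommGroup E] [NormedSpace ℝ E]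
  {M : Type*} [TopologicalSpace M] [ChartedSpace E M]

theorem velocity_congr {c c' : ℝ → M} {t : ℝ} (h : c =ᶠ[𝓝 t] c') :
    (velocity c t : TangentBundle 𝓘(ℝ, E) M) = velocity c' t := by
  have h1 := h.mfderiv_eq (I := 𝓘(ℝ, ℝ)) (I' := 𝓘(ℝ, E))
  have h2 := h.self_of_nhds
  have key : ∀ (x y : M), x = y → ∀ X : E, (⟨x, X⟩ : TangentBundle 𝓘(ℝ, E) M) = ⟨y, X⟩ := by
    rintro x y rfl X; rfl
  unfold velocity
  refine (key _ _ h2 _).trans ?_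
  rw [h1]
  rfl

theorem velocity_comp {c : ℝ → M} {θ : ℝ → ℝ} {s : ℝ}
    (hc : MDifferentiableAt 𝓘(ℝ, ℝ) 𝓘(ℝ, E) c (θ s)) (hθ : DifferentiableAt ℝ θ s) :
    (velocity (c ∘ θ) s : TangentBundle 𝓘(ℝ, E) M) =
      ⟨c (θ s), deriv θ s • (velocity c (θ s) : TangentBundle 𝓘(ℝ, E) M).2⟩ := by
  have h := mfderiv_comp_apply s hc hθ.mdifferentiableAt (1 : ℝ)
  unfold velocity
  congr 1
  refine h.trans ?_
  have h6 := (mfderiv 𝓘(ℝ, ℝ) 𝓘(ℝ, E) c (θ s)).map_smul (deriv θ s) (1 : ℝ)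
  refine Eq.trans ?_ h6
  congr 1
  rw [mfderiv_eq_fderiv]
  exact (mul_one (deriv θ s)).symm

theorem smul_mem_slit {v : TangentBundle 𝓘(ℝ, E) M} (hv : v ∈ slit E M) {r : ℝ} (hr : r ≠ 0) :
    (⟨v.1, r • v.2⟩ : TangentBundle 𝓘(ℝ, E) M) ∈ slit E M :=
  smul_ne_zero hr hv

variable [IsManifold 𝓘(ℝ, E) ∞ M]
  {S S' : (v : TangentBundle 𝓘(ℝ, E) M) → TangentSpace 𝓘(ℝ, E).tangent v}
variable [FiniteDimensional ℝ E]

/-- The chain rule gives `(x ∘ θ)'' = θ'² x'' + θ'' x'`, while homogeneity gives the new force `θ'²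
f(x, x') - 2 P θ'² x'`. The difference is `(θ'' + 2 P θ'²) x'`, and `x' ≠ 0`. -/
theorem IsSpray.deriv_deriv_comp_eq_force_iff (hS : IsSpray S)
    {P : TangentBundle 𝓘(ℝ, E) M → ℝ}
    (hP : ∀ v ∈ slit E M, ∀ r : ℝ, 0 < r → P ⟨v.1, r • v.2⟩ = r * P v)
    (hSS' : ∀ v ∈ slit E M, S' v = S v - (2 * P v) • liouville v)
    {c : ℝ → M} {θ : ℝ → ℝ} {s : ℝ} (hc : ContMDiffAt 𝓘(ℝ, ℝ) 𝓘(ℝ, E) ∞ c (θ s))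
    (h0 : velocity c (θ s) ∈ slit E M) {p : M} (hp : c (θ s) ∈ (chartAt E p).source)
    (hx : deriv (deriv fun τ => extChartAt 𝓘(ℝ, E) p (c τ)) (θ s) =
      force p S (tangentChart p (velocity c (θ s))))
    (hθ : ContDiffAt ℝ ∞ θ s) (hθ0 : 0 < deriv θ s) :
    deriv (deriv fun τ => extChartAt 𝓘(ℝ, E) p ((c ∘ θ) τ)) s =
        force p S' (tangentChart p (velocity (c ∘ θ) s)) ↔
      deriv (deriv θ) s = -2 * P (velocity c (θ s)) * deriv θ s ^ 2 := by
  have hcd := hc.mdifferentiableAt (by simp)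
  have hθd := hθ.differentiableAt (by simp)
  have hv := tangentChart_velocity hcd hp
  have hp' : (velocity c (θ s) : TangentBundle 𝓘(ℝ, E) M).1 ∈ (chartAt E p).source := hp
  have hxs := contDiffAt_coordCurve hc hp
  set x : ℝ → E := fun τ => extChartAt 𝓘(ℝ, E) p (c τ) with hxdef
  have h1 : deriv (fun τ => extChartAt 𝓘(ℝ, E) p ((c ∘ θ) τ)) =ᶠ[𝓝 s]
      fun τ => deriv θ τ • deriv x (θ τ) := by
    have e1 : ∀ᶠ τ in 𝓝 (θ s), ContDiffAt ℝ 1 x τ :=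
      (hxs.of_le (m := 1) ENat.LEInfty.out).eventually (by simp)
    have e2 : ∀ᶠ τ in 𝓝 s, ContDiffAt ℝ 1 θ τ :=
      (hθ.of_le (m := 1) ENat.LEInfty.out).eventually (by simp)
    filter_upwards [hθd.continuousAt.eventually e1, e2] with τ h3 h4
    exact deriv.scomp τ (h3.differentiableAt (by simp)) (h4.differentiableAt (by simp))
  have h2 : HasDerivAt (fun τ => deriv θ τ • deriv x (θ τ))
      (deriv θ s • (deriv θ s • deriv (deriv x) (θ s)) + deriv (deriv θ) s • deriv x (θ s)) s :=
    (hθ.deriv_of_infty.differentiableAt (by simp)).hasDerivAt.smul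
      ((hxs.deriv_of_infty.differentiableAt (by simp)).hasDerivAt.scomp s hθd.hasDerivAt)
  rw [h1.deriv_eq, h2.deriv, velocity_comp hcd hθd]
  have hsl := smul_mem_slit h0 hθ0.ne'
  have hy : deriv x (θ s) ≠ 0 := by
    have := (mem_slit_iff hp').1 h0
    rwa [hv] at this
  have hxt : x (θ s) ∈ (chartAt E p).target := (chartAt E p).map_source hp
  have h3 := force_tangentChart_sub_smul (S := S) (S' := S') (P := P) (p := p)
    (v := ⟨c (θ s), deriv θ s • (velocity c (θ s) : TangentBundle 𝓘(ℝ, E) M).2⟩) hp (hSS' _ hsl)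
  have h4 := tangentChart_smul hp' (deriv θ s)
  have h5 : P ⟨c (θ s), deriv θ s • (velocity c (θ s) : TangentBundle 𝓘(ℝ, E) M).2⟩ =
    deriv θ s * P (velocity c (θ s)) := hP _ h0 _ hθ0
  change tangentChart p ⟨c (θ s), deriv θ s • (velocity c (θ s) : TangentBundle 𝓘(ℝ, E) M).2⟩ = _
    at h4
  rw [h3, h5, h4, hx, hv]
  simp only
  rw [hS.force_smul hxt hy hθ0, ← sub_eq_zero, ← sub_eq_zero (b := -2 * _ * _)]
  have h6 : deriv θ s • deriv θ s • force p S (x (θ s), deriv x (θ s)) +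
      deriv (deriv θ) s • deriv x (θ s) -
      (deriv θ s ^ 2 • force p S (x (θ s), deriv x (θ s)) -
        (2 * (deriv θ s * P (velocity c (θ s)))) • deriv θ s • deriv x (θ s)) =
      (deriv (deriv θ) s - -2 * P (velocity c (θ s)) * deriv θ s ^ 2) • deriv x (θ s) := by
    module
  rw [h6, smul_eq_zero]
  simp [hy]

/-- The curve `c'` need only agree with `c ∘ θ` on `I'`. This freedom serves the converse
implication, where `c` and `(c ∘ θ) ∘ θ⁻¹` are known to agree only on the interval. -/
theorem IsGeodesicOn.deriv_deriv_of_comp (hS : IsSpray S) (hS' : IsSpray S') 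
    {P : TangentBundle 𝓘(ℝ, E) M → ℝ}
    (hP : ∀ v ∈ slit E M, ∀ r : ℝ, 0 < r → P ⟨v.1, r • v.2⟩ = r * P v)
    (hSS' : ∀ v ∈ slit E M, S' v = S v - (2 * P v) • liouville v)
    {c c' : ℝ → M} {θ : ℝ → ℝ} {I I' : Set ℝ} (hI : IsOpen I) (hI' : IsOpen I')
    (hc : IsGeodesicOn S c I) (hc' : IsGeodesicOn S' c' I') (hcc' : EqOn c' (c ∘ θ) I')
    (hm : MapsTo θ I' I) (hθ : ContDiffOn ℝ ∞ θ I') (hθ0 : ∀ s ∈ I', 0 < deriv θ s)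
    {s : ℝ} (hs : s ∈ I') :
    deriv (deriv θ) s = -2 * P (velocity c (θ s)) * deriv θ s ^ 2 := by
  have hev : c' =ᶠ[𝓝 s] c ∘ θ := hcc'.eventuallyEq_of_mem (hI'.mem_nhds hs)
  have hp := mem_chart_source E (c (θ s))
  have hp' : c' s ∈ (chartAt E (c (θ s))).source := by rw [hcc' hs]; exact hp
  have h1 := hc'.deriv_deriv_eq hS' hI' hs hp'
  rw [velocity_congr hev] at h1
  rw [← hS.deriv_deriv_comp_eq_force_iff hP hSS' (hc.smooth.contMDiffAt (hI.mem_nhds (hm hs)))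
    (hc.regular _ (hm hs)) hp (hc.deriv_deriv_eq hS hI (hm hs) hp)
    (hθ.contDiffAt (hI'.mem_nhds hs)) (hθ0 s hs), ← h1]
  have h2 : (fun τ => extChartAt 𝓘(ℝ, E) (c (θ s)) ((c ∘ θ) τ)) =ᶠ[𝓝 s]
      fun τ => extChartAt 𝓘(ℝ, E) (c (θ s)) (c' τ) := hev.symm.fun_comp _
  exact h2.deriv.deriv_eq

theorem IsGeodesicOn.comp (hS : IsSpray S) (hS' : IsSpray S') 
    {P : TangentBundle 𝓘(ℝ, E) M → ℝ}
    (hP : ∀ v ∈ slit E M, ∀ r : ℝ, 0 < r → P ⟨v.1, r • v.2⟩ = r * P v)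
    (hSS' : ∀ v ∈ slit E M, S' v = S v - (2 * P v) • liouville v)
    {c : ℝ → M} {θ : ℝ → ℝ} {I I' : Set ℝ} (hI : IsOpen I) (hI' : IsOpen I')
    (hc : IsGeodesicOn S c I)
    (hm : MapsTo θ I' I) (hθ : ContDiffOn ℝ ∞ θ I') (hθ0 : ∀ s ∈ I', 0 < deriv θ s)
    (h : ∀ s ∈ I', deriv (deriv θ) s = -2 * P (velocity c (θ s)) * deriv θ s ^ 2) :
    IsGeodesicOn S' (c ∘ θ) I' := by
  refine hS'.isGeodesicOn hI' (hc.smooth.comp hθ.contMDiffOn hm) (fun s hs => ?_) fun s hs => ?_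
  · rw [velocity_comp ((hc.smooth.contMDiffAt (hI.mem_nhds (hm hs))).mdifferentiableAt (by simp))
      ((hθ.contDiffAt (hI'.mem_nhds hs)).differentiableAt (by simp))]
    exact smul_mem_slit (hc.regular _ (hm hs)) (hθ0 s hs).ne'
  · have hp := mem_chart_source E (c (θ s))
    exact (hS.deriv_deriv_comp_eq_force_iff hP hSS' (hc.smooth.contMDiffAt (hI.mem_nhds (hm hs)))
      (hc.regular _ (hm hs)) hp (hc.deriv_deriv_eq hS hI (hm hs) hp)
      (hθ.contDiffAt (hI'.mem_nhds hs)) (hθ0 s hs)).2 (h s hs)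

end Reparametrization

/-! ### Smooth dependence of primitives on a parameter. -/

section ParametricPrimitive

open Filter Topology MeasureTheory intervalIntegral

variable {U I : Set ℝ} {p : ℝ × ℝ → ℝ} {t₀ : ℝ}

theorem _root_.Set.OrdConnected.exists_Icc_subset (hI : IsOpen I) (hI' : I.OrdConnected) {x y : ℝ}
    (hx : x ∈ I) (hy : y ∈ I) : ∃ a b, x ∈ Ioo a b ∧ y ∈ Ioo a b ∧ Icc a b ⊆ I := by
  have hm : min x y ∈ I := by rcases min_choice x y with h | h <;> rw [h] <;> assumption
  have hM : max x y ∈ I := by rcases max_choice x y with h | h <;> rw [h] <;> assumption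
  obtain ⟨r, hr, h1⟩ := Metric.isOpen_iff.1 hI _ hm
  obtain ⟨R, hR, h2⟩ := Metric.isOpen_iff.1 hI _ hM
  refine ⟨min x y - r / 2, max x y + R / 2, ⟨?_, ?_⟩, ⟨?_, ?_⟩, hI'.out (h1 ?_) (h2 ?_)⟩
  · linarith [min_le_left x y]
  · linarith [le_max_left x y]
  · linarith [min_le_right x y]
  · linarith [le_max_right x y]
  · rw [Metric.mem_ball, Real.dist_eq, abs_lt]; constructor <;> linarith
  · rw [Metric.mem_ball, Real.dist_eq, abs_lt]; constructor <;> linarith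

theorem exists_Icc_subset_of_isOpen (hU : IsOpen U) {x : ℝ} (hx : x ∈ U) :
    ∃ a b, x ∈ Ioo a b ∧ Icc a b ⊆ U := by
  obtain ⟨r, hr, h1⟩ := Metric.isOpen_iff.1 hU _ hx
  refine ⟨x - r / 2, x + r / 2, ⟨by linarith, by linarith⟩, fun y hy => h1 ?_⟩
  rw [Metric.mem_ball, Real.dist_eq, abs_lt]
  constructor <;> linarith [hy.1, hy.2]

theorem continuousOn_parametric_primitive (hU : IsOpen U) (hI : IsOpen I) (hI' : I.OrdConnected)
    (hp : ContinuousOn p (U ×ˢ I)) (ht₀ : t₀ ∈ I) :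
    ContinuousOn (fun q : ℝ × ℝ => ∫ τ in t₀..q.2, p (q.1, τ)) (U ×ˢ I) := by
  rintro ⟨u, t⟩ ⟨hu, ht⟩
  obtain ⟨a, b, hua, hab⟩ := exists_Icc_subset_of_isOpen hU hu
  obtain ⟨a', b', h0, ht', hab'⟩ := hI'.exists_Icc_subset hI ht₀ ht
  have hab1 : a ≤ b := (hua.1.trans hua.2).le
  have hab1' : a' ≤ b' := (h0.1.trans h0.2).le
  -- Clamping both coordinates retracts the plane onto a compact rectangle inside `U ×ˢ I`; `p ∘ k`
  -- is continuous everywhere and has the same primitives near the given point.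
  let k : ℝ × ℝ → ℝ × ℝ := fun q => (max a (min b q.1), max a' (min b' q.2))
  have hk : Continuous k := by unfold k; fun_prop
  have hkm : ∀ q, k q ∈ U ×ˢ I := fun q =>
    ⟨hab ⟨le_max_left _ _, max_le hab1 (min_le_left _ _)⟩,
      hab' ⟨le_max_left _ _, max_le hab1' (min_le_left _ _)⟩⟩
  have hk' : ∀ q ∈ Icc a b ×ˢ Icc a' b', k q = q := by
    rintro ⟨x, y⟩ ⟨hx, hy⟩
    simp only [k]
    rw [min_eq_right hx.2, min_eq_right hy.2, max_eq_right hx.1, max_eq_right hy.1]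
  have hc : Continuous fun q : ℝ × ℝ => p (k q) := hp.comp_continuous hk hkm
  have h1 : Continuous fun q : ℝ × ℝ => ∫ τ in t₀..q.2, p (k (q.1, τ)) :=
    continuous_parametric_intervalIntegral_of_continuous
      (f := fun (q : ℝ × ℝ) τ => p (k (q.1, τ))) (s := fun q => q.2)
      (hc.comp (by fun_prop : Continuous fun x : (ℝ × ℝ) × ℝ => (x.1.1, x.2))) continuous_snd
  refine (h1.continuousAt.congr ?_).continuousWithinAt
  filter_upwards [prod_mem_nhds (Ioo_mem_nhds hua.1 hua.2) (Ioo_mem_nhds ht'.1 ht'.2)] with q hq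
  refine integral_congr fun τ hτ => ?_
  rw [hk' (q.1, τ) ⟨Ioo_subset_Icc_self hq.1, ?_⟩]
  exact ordConnected_Icc.uIcc_subset (Ioo_subset_Icc_self h0) (Ioo_subset_Icc_self hq.2) hτ

theorem hasDerivAt_primitive_right (hI : IsOpen I) (hI' : I.OrdConnected) {f : ℝ → ℝ}
    (hf : ContinuousOn f I) (ht₀ : t₀ ∈ I) {t : ℝ} (ht : t ∈ I) :
    HasDerivAt (fun t => ∫ τ in t₀..t, f τ) (f t) t :=
  integral_hasDerivAt_right
    (hf.mono (hI'.uIcc_subset ht₀ ht)).intervalIntegrable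
    (hf.stronglyMeasurableAtFilter hI t ht) (hf.continuousAt (hI.mem_nhds ht))

theorem hasDerivAt_parametric_integral (hU : IsOpen U) (hI : IsOpen I) (hI' : I.OrdConnected)
    (hp : ContDiffOn ℝ 1 p (U ×ˢ I)) (ht₀ : t₀ ∈ I) {u t : ℝ} (hu : u ∈ U) (ht : t ∈ I) :
    HasDerivAt (fun u => ∫ τ in t₀..t, p (u, τ)) (∫ τ in t₀..t, fderiv ℝ p (u, τ) (1, 0)) u := by
  obtain ⟨a, b, hua, hab⟩ := exists_Icc_subset_of_isOpen hU hu
  have hUI := hU.prod hI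
  have hsub := hI'.uIcc_subset ht₀ ht
  have hc' : ContinuousOn (fun q => fderiv ℝ p q (1, 0)) (U ×ˢ I) :=
    (hp.continuousOn_fderiv_of_isOpen hUI (by simp)).clm_apply continuousOn_const
  have hs : ∀ {f : ℝ × ℝ → ℝ}, ContinuousOn f (U ×ˢ I) → ∀ v ∈ U,
      ContinuousOn (fun τ => f (v, τ)) (uIcc t₀ t) := fun hf v hv =>
    hf.comp (by fun_prop) fun τ hτ => ⟨hv, hsub hτ⟩
  -- A bound for `∂p/∂u` on a compact rectangle dominates the differentiation under the integral
  -- sign.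
  obtain ⟨C, hC⟩ := (isCompact_Icc.prod isCompact_uIcc).exists_bound_of_continuousOn
    (hc'.mono (prod_mono hab hsub))
  refine (intervalIntegral.hasDerivAt_integral_of_dominated_loc_of_deriv_le (bound := fun _ => C)
    (F := fun u τ => p (u, τ)) (F' := fun u τ => fderiv ℝ p (u, τ) (1, 0))
    (Icc_mem_nhds hua.1 hua.2) ?_ ?_ ?_ ?_ ?_ ?_).2
  · filter_upwards [hU.mem_nhds hu] with v hv
    exact (hs hp.continuousOn v hv).intervalIntegrable.def'.aestronglyMeasurable
  · exact (hs hp.continuousOn u hu).intervalIntegrable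
  · exact (hs hc' u hu).intervalIntegrable.def'.aestronglyMeasurable
  · exact ae_of_all _ fun τ hτ v hv => hC (v, τ) ⟨hv, uIoc_subset_uIcc hτ⟩
  · exact intervalIntegrable_const
  · refine ae_of_all _ fun τ hτ v hv => ?_
    have hd := (hp.contDiffAt (x := (v, τ))
      (hUI.mem_nhds ⟨hab hv, hsub (uIoc_subset_uIcc hτ)⟩)).differentiableAt
      (by simp)
    have h1 : HasDerivAt (fun u : ℝ => (u, τ)) ((1 : ℝ), (0 : ℝ)) v :=
      (hasDerivAt_id v).prodMk (hasDerivAt_const v τ)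
    exact hd.hasFDerivAt.comp_hasDerivAt v h1

/-- Both partial derivatives exist and are jointly continuous, which gives the total derivative. -/
theorem hasFDerivAt_parametric_primitive (hU : IsOpen U) (hI : IsOpen I) (hI' : I.OrdConnected)
    (hp : ContDiffOn ℝ 1 p (U ×ˢ I)) (ht₀ : t₀ ∈ I) {q : ℝ × ℝ} (hq : q ∈ U ×ˢ I) :
    HasFDerivAt (fun q : ℝ × ℝ => ∫ τ in t₀..q.2, p (q.1, τ))
      ((∫ τ in t₀..q.2, fderiv ℝ p (q.1, τ) (1, 0)) • ContinuousLinearMap.fst ℝ ℝ ℝ +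
        p q • ContinuousLinearMap.snd ℝ ℝ ℝ) q := by
  have hUI := hU.prod hI
  have hc' : ContinuousOn (fun q => fderiv ℝ p q (1, 0)) (U ×ˢ I) :=
    (hp.continuousOn_fderiv_of_isOpen hUI (by simp)).clm_apply continuousOn_const
  have hev := hUI.mem_nhds hq
  have := hasStrictFDerivAt_uncurry_coprod (𝕜 := ℝ) (u := q)
    (f := fun u t => ∫ τ in t₀..t, p (u, τ))
    (f₁ := fun u t => ContinuousLinearMap.toSpanSingleton ℝ
      (∫ τ in t₀..t, fderiv ℝ p (u, τ) (1, 0)))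
    (f₂ := fun u t => ContinuousLinearMap.toSpanSingleton ℝ (p (u, t))) ?_ ?_ ?_ ?_
  · refine this.hasFDerivAt.congr_fderiv ?_
    ext <;> simp [Function.HasUncurry.uncurry]
  · filter_upwards [hev] with v hv
    exact (hasDerivAt_parametric_integral hU hI hI' hp ht₀ hv.1 hv.2).hasFDerivAt
  · filter_upwards [hev] with v hv
    exact (hasDerivAt_primitive_right hI hI' (f := fun t => p (v.1, t))
      (hp.continuousOn.comp (by fun_prop) fun τ hτ => ⟨hv.1, hτ⟩) ht₀ hv.2).hasFDerivAt
  · exact (ContinuousLinearMap.toSpanSingletonCLE (𝕜 := ℝ) (E := ℝ)).continuous.continuousAt.comp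
      ((continuousOn_parametric_primitive hU hI hI' hc' ht₀).continuousAt hev)
  · exact (ContinuousLinearMap.toSpanSingletonCLE (𝕜 := ℝ) (E := ℝ)).continuous.continuousAt.comp
      (hp.continuousOn.continuousAt hev)

/-- The `t`-derivative of the primitive is `p`, and its `u`-derivative is the primitive of `∂p/∂u`,
a function of the same kind. So the order of smoothness rises by induction over all `p` at once. -/
theorem contDiffOn_parametric_primitive (hU : IsOpen U) (hI : IsOpen I) (hI' : I.OrdConnected)
    (hp : ContDiffOn ℝ ∞ p (U ×ˢ I)) (ht₀ : t₀ ∈ I) :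
    ContDiffOn ℝ ∞ (fun q : ℝ × ℝ => ∫ τ in t₀..q.2, p (q.1, τ)) (U ×ˢ I) := by
  rw [contDiffOn_infty]
  intro n
  have hUI := hU.prod hI
  induction n generalizing p with
  | zero =>
    exact contDiffOn_zero.2 (continuousOn_parametric_primitive hU hI hI' hp.continuousOn ht₀)
  | succ n ih =>
    have hc' : ContDiffOn ℝ ∞ (fun q => fderiv ℝ p q (1, 0)) (U ×ˢ I) :=
      (hp.fderiv_of_isOpen hUI le_rfl).clm_apply contDiffOn_const
    push_cast
    rw [contDiffOn_succ_iff_hasFDerivWithinAt_of_uniqueDiffOn hUI.uniqueDiffOn]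
    refine ⟨by simp, _, ?_, fun q hq => (hasFDerivAt_parametric_primitive hU hI hI'
      (hp.of_le ENat.LEInfty.out) ht₀ hq).hasFDerivWithinAt⟩
    exact ((ih hc').smul contDiffOn_const).add
      ((hp.of_le (by exact_mod_cast le_top)).smul contDiffOn_const)

end ParametricPrimitive

/-! ### Inverting a family of increasing functions smoothly. -/

section FamilyOfInverses

open Filter Topology

variable {U I : Set ℝ} {F : ℝ × ℝ → ℝ}

theorem strictMonoOn_of_fderiv_pos (hU : IsOpen U) (hI : IsOpen I) (hI' : I.OrdConnected)
    (hF : ContDiffOn ℝ ∞ F (U ×ˢ I)) (h0 : ∀ q ∈ U ×ˢ I, 0 < fderiv ℝ F q (0, 1))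
    {u : ℝ} (hu : u ∈ U) : StrictMonoOn (fun t => F (u, t)) I := by
  have hd : ∀ t ∈ I, HasDerivAt (fun t => F (u, t)) (fderiv ℝ F (u, t) (0, 1)) t := fun t ht =>
    ((hF.contDiffAt ((hU.prod hI).mem_nhds (mk_mem_prod hu ht))).differentiableAt
      (by simp)).hasFDerivAt.comp_hasDerivAt t ((hasDerivAt_const t u).prodMk (hasDerivAt_id t))
  refine strictMonoOn_of_deriv_pos hI'.convex
    (fun t ht => (hd t ht).continuousAt.continuousWithinAt) fun t ht => ?_
  rw [hI.interior_eq] at ht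
  rw [(hd t ht).deriv]
  exact h0 _ ⟨hu, ht⟩

/-- The inverse function theorem applies to `(u, t) ↦ (u, F(u, t))`. Monotonicity of each slice
makes the inverse globally single-valued on the image, so the local inverses glue. -/
theorem exists_contDiffOn_inverse_family (hU : IsOpen U) (hI : IsOpen I) (hI' : I.OrdConnected)
    (hF : ContDiffOn ℝ ∞ F (U ×ˢ I)) (h0 : ∀ q ∈ U ×ˢ I, 0 < fderiv ℝ F q (0, 1)) :
    ∃ Θ : ℝ × ℝ → ℝ, IsOpen ((fun q : ℝ × ℝ => (q.1, F q)) '' (U ×ˢ I)) ∧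
      ContDiffOn ℝ ∞ Θ ((fun q : ℝ × ℝ => (q.1, F q)) '' (U ×ˢ I)) ∧
      ∀ q ∈ U ×ˢ I, Θ (q.1, F q) = q.2 := by
  let Θ : ℝ × ℝ → ℝ := fun y => Function.invFunOn (fun t => F (y.1, t)) I y.2
  let G : ℝ × ℝ → ℝ × ℝ := fun q => (q.1, F q)
  have hΘ : ∀ q ∈ U ×ˢ I, Θ (G q) = q.2 := fun q hq =>
    (strictMonoOn_of_fderiv_pos hU hI hI' hF h0 hq.1).injOn.leftInvOn_invFunOn hq.2
  have hUI := hU.prod hI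
  have key : ∀ q ∈ U ×ˢ I, ∃ H : ℝ × ℝ → ℝ × ℝ, ContDiffAt ℝ ∞ H (G q) ∧
      ∀ᶠ y in 𝓝 (G q), H y ∈ U ×ˢ I ∧ G (H y) = y := by
    intro q hq
    have hFq := hF.contDiffAt (hUI.mem_nhds hq)
    have hG : ContDiffAt ℝ ∞ G q := contDiffAt_fst.prodMk hFq
    -- The derivative is triangular with diagonal entries `1` and `∂F/∂t > 0`, hence injective,
    -- hence invertible in finite dimension.
    let L : ℝ × ℝ →L[ℝ] ℝ × ℝ := (ContinuousLinearMap.fst ℝ ℝ ℝ).prod (fderiv ℝ F q)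
    have hL : Function.Injective L := by
      rw [injective_iff_map_eq_zero]
      rintro ⟨a, b⟩ hab
      have ha : a = 0 := congrArg Prod.fst hab
      subst ha
      have hb : fderiv ℝ F q (0, b) = 0 := congrArg Prod.snd hab
      have h3 : ((0 : ℝ), b) = b • ((0 : ℝ), (1 : ℝ)) := by simp
      rw [h3, map_smul, smul_eq_mul, mul_eq_zero] at hb
      rw [hb.resolve_right (h0 q hq).ne']
      rfl
    let e : (ℝ × ℝ) ≃L[ℝ] ℝ × ℝ :=
      (LinearEquiv.ofInjectiveEndo (L : ℝ × ℝ →ₗ[ℝ] ℝ × ℝ) hL).toContinuousLinearEquiv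
    have hGd : HasFDerivAt G (e : ℝ × ℝ →L[ℝ] ℝ × ℝ) q :=
      hasFDerivAt_fst.prodMk (hFq.differentiableAt (by simp)).hasFDerivAt
    let H := hG.toOpenPartialHomeomorph G hGd (by simp)
    have hHs : q ∈ H.source := hG.mem_toOpenPartialHomeomorph_source hGd (by simp)
    have hHt : G q ∈ H.target := H.map_source hHs
    refine ⟨H.symm, hG.to_localInverse hGd (by simp), ?_⟩
    have h4 : H.symm (G q) = q := H.left_inv hHs
    have h5 : ContinuousAt H.symm (G q) := H.continuousAt_symm hHt
    filter_upwards [H.open_target.mem_nhds hHt,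
      h5.eventually_mem (by rw [h4]; exact hUI.mem_nhds hq)] with y hy hy'
    exact ⟨hy', H.right_inv hy⟩
  refine ⟨Θ, ?_, ?_, hΘ⟩
  · rw [isOpen_iff_mem_nhds]
    rintro _ ⟨q, hq, rfl⟩
    obtain ⟨H, -, h⟩ := key q hq
    exact h.mono fun y hy => ⟨H y, hy.1, hy.2⟩
  · rintro _ ⟨q, hq, rfl⟩
    obtain ⟨H, hH, h⟩ := key q hq
    refine (hH.snd.congr_of_eventuallyEq ?_).contDiffWithinAt
    filter_upwards [h] with y hy
    rw [← hΘ _ hy.1, hy.2]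

end FamilyOfInverses

/-! ### The parameter change as an inverse of a solution of `f'' = 2 p f'`. -/

section ReparametrizationODE

variable {p Q f θ : ℝ → ℝ} {I J : Set ℝ} {k : ℝ}

theorem eq_of_hasDerivAt_zero (hJ : IsOpen J) (hJ' : J.OrdConnected) {g : ℝ → ℝ}
    (hg : ∀ s ∈ J, HasDerivAt g 0 s) {x y : ℝ} (hx : x ∈ J) (hy : y ∈ J) : g x = g y :=
  hJ'.convex.is_const_of_fderivWithin_eq_zero (𝕜 := ℝ)
    (fun r hr => (hg r hr).differentiableAt.differentiableWithinAt) (fun r hr => by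
      rw [fderivWithin_of_isOpen hJ hr]
      ext; simp [(hg r hr).deriv]) hx hy

/-- An affine function with two distinct zeros is zero. -/
theorem eq_zero_of_deriv_deriv_eq_zero (hJ : IsOpen J) (hJ' : J.OrdConnected) {g : ℝ → ℝ}
    (hg : ∀ s ∈ J, ContDiffAt ℝ ∞ g s) (hg' : ∀ s ∈ J, deriv (deriv g) s = 0) {x y : ℝ}
    (hx : x ∈ J) (hy : y ∈ J) (hxy : x ≠ y) (hgx : g x = 0) (hgy : g y = 0) {s : ℝ}
    (hs : s ∈ J) : g s = 0 := by
  have h1 : ∀ s ∈ J, HasDerivAt (deriv g) 0 s := fun s hs => by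
    rw [← hg' s hs]
    exact ((hg s hs).deriv_of_infty.differentiableAt (by simp)).hasDerivAt
  have h2 : ∀ s ∈ J, HasDerivAt (fun s => g s - deriv g x * s) 0 s := fun s hs => by
    refine (((hg s hs).differentiableAt (by simp)).hasDerivAt.sub
      ((hasDerivAt_id s).const_mul (deriv g x))).congr_deriv ?_
    rw [eq_of_hasDerivAt_zero hJ hJ' h1 hs hx]
    ring
  have e1 := eq_of_hasDerivAt_zero hJ hJ' h2 hy hx
  have e2 := eq_of_hasDerivAt_zero hJ hJ' h2 hs hx
  simp only [hgx, hgy] at e1 e2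
  have h3 : deriv g x = 0 := by
    have : deriv g x * (y - x) = 0 := by linarith
    exact (mul_eq_zero.1 this).resolve_right (sub_ne_zero.2 hxy.symm)
  rw [h3] at e2
  linarith

/-- Differentiate `f (θ s) = s`. With `Q` a primitive of `p`, the hypothesis on `f'` is the
once-integrated form of `f'' = 2 p f'`. -/
theorem deriv_eq_of_leftInverse (hJ : IsOpen J)
    (hf : ∀ t ∈ I, HasDerivAt f (k * Real.exp (2 * Q t)) t)
    (hk : 0 < k) (hm : MapsTo θ J I) (hθ : ∀ s ∈ J, DifferentiableAt ℝ θ s)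
    (hfθ : ∀ s ∈ J, f (θ s) = s) {s : ℝ} (hs : s ∈ J) :
    deriv θ s = k⁻¹ * Real.exp (-(2 * Q (θ s))) := by
  have h1 := (hf _ (hm hs)).comp s (hθ s hs).hasDerivAt
  have h2 : (f ∘ θ) =ᶠ[nhds s] id := by
    filter_upwards [hJ.mem_nhds hs] with r hr using hfθ r hr
  have h3 := h1.unique ((hasDerivAt_id s).congr_of_eventuallyEq h2)
  rw [Real.exp_neg]
  have := Real.exp_pos (2 * Q (θ s))
  field_simp
  linarith

theorem deriv_deriv_eq_of_leftInverse (hJ : IsOpen J) (hQ : ∀ t ∈ I, HasDerivAt Q (p t) t)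
    (hf : ∀ t ∈ I, HasDerivAt f (k * Real.exp (2 * Q t)) t)
    (hk : 0 < k) (hm : MapsTo θ J I) (hθ : ∀ s ∈ J, DifferentiableAt ℝ θ s)
    (hfθ : ∀ s ∈ J, f (θ s) = s) {s : ℝ} (hs : s ∈ J) :
    deriv (deriv θ) s = -2 * p (θ s) * deriv θ s ^ 2 := by
  have h1 : deriv θ =ᶠ[nhds s] fun s => k⁻¹ * Real.exp (-(2 * Q (θ s))) := by
    filter_upwards [hJ.mem_nhds hs] with r hr
    exact deriv_eq_of_leftInverse hJ hf hk hm hθ hfθ hr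
  have h2 := (((((hQ _ (hm hs)).comp s (hθ s hs).hasDerivAt).const_mul 2).neg).exp).const_mul k⁻¹
  rw [h1.deriv_eq]
  refine h2.deriv.trans ?_
  have h3 := h1.self_of_nhds
  simp only [Function.comp, Pi.neg_apply] at h3 ⊢
  rw [sq]
  -- Only one of the two factors of `θ'²` is expanded; the other matches the chain rule factor.
  nth_rewrite 3 [h3]
  ring

/-- Uniqueness for the boundary value problem: the equation for `θ` makes `(f ∘ θ)'` constant, so `f
∘ θ` is affine, and an affine map fixing two distinct points is the identity. -/
theorem leftInverse_of_deriv_deriv_eq (hJ : IsOpen J) (hJ' : J.OrdConnected)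
    (hQ : ∀ t ∈ I, HasDerivAt Q (p t) t)
    (hf : ∀ t ∈ I, HasDerivAt f (k * Real.exp (2 * Q t)) t)
    (hm : MapsTo θ J I) (hθ : ContDiffOn ℝ ∞ θ J)
    (hθ' : ∀ s ∈ J, deriv (deriv θ) s = -2 * p (θ s) * deriv θ s ^ 2)
    {s₀ s₁ : ℝ} (hs₀ : s₀ ∈ J) (hs₁ : s₁ ∈ J) (hne : s₀ ≠ s₁) (h0 : f (θ s₀) = s₀)
    (h1 : f (θ s₁) = s₁) {s : ℝ} (hs : s ∈ J) : f (θ s) = s := by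
  have hθd : ∀ s ∈ J, HasDerivAt θ (deriv θ s) s := fun s hs =>
    ((hθ.contDiffAt (hJ.mem_nhds hs)).differentiableAt (by simp)).hasDerivAt
  have hθdd : ∀ s ∈ J, HasDerivAt (deriv θ) (deriv (deriv θ) s) s := fun s hs =>
    (((hθ.contDiffAt (hJ.mem_nhds hs)).deriv_of_infty).differentiableAt (by simp)).hasDerivAt
  -- This is `(f ∘ θ)'`.
  let w : ℝ → ℝ := fun s => k * Real.exp (2 * Q (θ s)) * deriv θ s
  have hw : ∀ s ∈ J, HasDerivAt w 0 s := by
    intro s hs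
    have h2 := ((((hQ _ (hm hs)).comp s (hθd s hs)).const_mul 2).exp.const_mul k).mul (hθdd s hs)
    refine h2.congr_deriv ?_
    rw [hθ' s hs]
    simp only [Function.comp]
    ring
  let β := w s₀
  have hg : ∀ s ∈ J, HasDerivAt (fun s => f (θ s) - β * s) 0 s := by
    intro s hs
    have h2 := ((hf _ (hm hs)).comp s (hθd s hs)).sub ((hasDerivAt_id s).const_mul β)
    refine h2.congr_deriv ?_
    have h3 : w s = β := eq_of_hasDerivAt_zero hJ hJ' hw hs hs₀
    simp only [w] at h3
    rw [h3]; ring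
  have e1 := eq_of_hasDerivAt_zero hJ hJ' hg hs₁ hs₀
  have e2 := eq_of_hasDerivAt_zero hJ hJ' hg hs hs₀
  simp only [h0, h1] at e1 e2
  have hβ : β = 1 := by
    have : (s₁ - s₀) * (1 - β) = 0 := by linarith
    rcases mul_eq_zero.1 this with h | h
    · exact absurd (by linarith) hne
    · linarith
  rw [hβ] at e2
  linarith

end ReparametrizationODE

/-! ### The linearized geodesic equation in coordinates. -/

section Variation

open Filter Topology

variable {E : Type*} [NormedAddCommGroup E] [NormedSpace ℝ E]

theorem _root_.ContDiffAt.fderiv_apply_const {G : Type*} [NormedAddCommGroup G] [NormedSpace ℝ G]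
    {g : G → E} {q : G} (hg : ContDiffAt ℝ ∞ g q) (v : G) :
    ContDiffAt ℝ ∞ (fun q => fderiv ℝ g q v) q :=
  (hg.fderiv_right (m := ∞) le_rfl).clm_apply contDiffAt_const

theorem fderiv_fderiv_apply_comm {G : Type*} [NormedAddCommGroup G] [NormedSpace ℝ G]
    {g : G → E} {q : G} (hg : ContDiffAt ℝ ∞ g q) (v w : G) :
    fderiv ℝ (fun q => fderiv ℝ g q v) q w = fderiv ℝ (fun q => fderiv ℝ g q w) q v := by
  have hd : DifferentiableAt ℝ (fderiv ℝ g) q :=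
    (hg.fderiv_right (m := ∞) le_rfl).differentiableAt (by simp)
  have h1 : ∀ v w, fderiv ℝ (fun q => fderiv ℝ g q v) q w = fderiv ℝ (fderiv ℝ g) q w v := by
    intro v w
    rw [fderiv_clm_apply hd (differentiableAt_const v)]
    simp
  rw [h1, h1]
  exact (hg.isSymmSndFDerivAt (by rw [minSmoothness_of_isRCLikeNormedField]; exact ENat.LEInfty.out)) w v

/-- The linearization of `x'' = f (x, x')` along a family of solutions. -/
theorem fderiv_variation {X : ℝ × ℝ → E} {f : E × E → E} {q : ℝ × ℝ} (hX : ContDiffAt ℝ ∞ X q)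
    (hf : DifferentiableAt ℝ f (X q, fderiv ℝ X q (0, 1)))
    (h : ∀ᶠ q in 𝓝 q, ContDiffAt ℝ ∞ X q ∧ fderiv ℝ (fun q => fderiv ℝ X q (0, 1)) q (0, 1) =
      f (X q, fderiv ℝ X q (0, 1))) :
    fderiv ℝ (fun q => fderiv ℝ (fun q => fderiv ℝ X q (1, 0)) q (0, 1)) q (0, 1) =
      fderiv ℝ f (X q, fderiv ℝ X q (0, 1))
        (fderiv ℝ X q (1, 0), fderiv ℝ (fun q => fderiv ℝ X q (1, 0)) q (0, 1)) := by
  have hXt := ContDiffAt.fderiv_apply_const hX (0, 1)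
  have h1 : (fun q => fderiv ℝ (fun q => fderiv ℝ X q (1, 0)) q (0, 1)) =ᶠ[𝓝 q]
      fun q => fderiv ℝ (fun q => fderiv ℝ X q (0, 1)) q (1, 0) :=
    h.mono fun q hq => fderiv_fderiv_apply_comm hq.1 _ _
  have h2 : (fun q => fderiv ℝ (fun q => fderiv ℝ X q (0, 1)) q (0, 1)) =ᶠ[𝓝 q]
      fun q => f (X q, fderiv ℝ X q (0, 1)) := h.mono fun q hq => hq.2
  -- Commuting the `u`-derivative past both `t`-derivatives turns the left side into the
  -- `u`-derivative of the equation.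
  rw [h1.fderiv_eq, fderiv_fderiv_apply_comm hXt, h2.fderiv_eq,
    fderiv_fderiv_apply_comm hX]
  have h3 := hf.hasFDerivAt.comp q
    ((hX.differentiableAt (by simp)).hasFDerivAt.prodMk (hXt.differentiableAt (by simp)).hasFDerivAt)
  exact congrArg (fun L => L (1, 0)) h3.fderiv

theorem hasDerivAt_slice_snd {X : ℝ × ℝ → E} {u t : ℝ} (hX : DifferentiableAt ℝ X (u, t)) :
    HasDerivAt (fun τ => X (u, τ)) (fderiv ℝ X (u, t) (0, 1)) t :=
  hX.hasFDerivAt.comp_hasDerivAt t ((hasDerivAt_const t u).prodMk (hasDerivAt_id t))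

theorem hasDerivAt_slice_fst {X : ℝ × ℝ → E} {u t : ℝ} (hX : DifferentiableAt ℝ X (u, t)) :
    HasDerivAt (fun u => X (u, t)) (fderiv ℝ X (u, t) (1, 0)) u :=
  hX.hasFDerivAt.comp_hasDerivAt u ((hasDerivAt_id u).prodMk (hasDerivAt_const u t))

/-- If the variation field of a family of solutions of `x'' = f (x, x')` is `g • x'`, where
`f` is positively homogeneous of degree two in `x'`, then `g'' = 0`. -/
theorem deriv_deriv_eq_zero_of_tangential {X : ℝ × ℝ → E} {f : E × E → E} {u t : ℝ}
    (hX : ContDiffAt ℝ ∞ X (u, t)) (h0 : fderiv ℝ X (u, t) (0, 1) ≠ 0)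
    (hf : DifferentiableAt ℝ f (X (u, t), fderiv ℝ X (u, t) (0, 1)))
    (hf2 : fderiv ℝ f (X (u, t), fderiv ℝ X (u, t) (0, 1)) (0, fderiv ℝ X (u, t) (0, 1)) =
      (2 : ℝ) • f (X (u, t), fderiv ℝ X (u, t) (0, 1)))
    (h : ∀ᶠ q in 𝓝 (u, t), ContDiffAt ℝ ∞ X q ∧
      fderiv ℝ (fun q => fderiv ℝ X q (0, 1)) q (0, 1) = f (X q, fderiv ℝ X q (0, 1)))
    {g : ℝ → ℝ} (hg : ContDiffAt ℝ ∞ g t)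
    (hgX : ∀ᶠ τ in 𝓝 t, fderiv ℝ X (u, τ) (1, 0) = g τ • fderiv ℝ X (u, τ) (0, 1)) :
    deriv (deriv g) t = 0 := by
  have hXt := ContDiffAt.fderiv_apply_const hX (0, 1)
  have hXu := ContDiffAt.fderiv_apply_const hX (1, 0)
  have hXut := ContDiffAt.fderiv_apply_const hXu (0, 1)
  have hin : ContinuousAt (fun τ : ℝ => (u, τ)) t := by fun_prop
  have hs := hin.eventually h
  have hge : ∀ᶠ τ in 𝓝 t, DifferentiableAt ℝ g τ :=
    ((hg.of_le (m := 1) ENat.LEInfty.out).eventually (by simp)).mono fun τ hτ =>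
      hτ.differentiableAt (by simp)
  set Xt : ℝ × ℝ → E := fun q => fderiv ℝ X q (0, 1) with hXtdef
  set Xu : ℝ × ℝ → E := fun q => fderiv ℝ X q (1, 0) with hXudef
  have hxt : ∀ᶠ τ in 𝓝 t, HasDerivAt (fun τ => Xt (u, τ)) (f (X (u, τ), Xt (u, τ))) τ := by
    filter_upwards [hs] with τ hτ
    have := hasDerivAt_slice_snd ((ContDiffAt.fderiv_apply_const hτ.1 (0, 1)).differentiableAt
      (by simp))
    rwa [hτ.2] at this
  have hz : ∀ᶠ τ in 𝓝 t, fderiv ℝ Xu (u, τ) (0, 1) =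
      g τ • f (X (u, τ), Xt (u, τ)) + deriv g τ • Xt (u, τ) := by
    filter_upwards [hs, hxt, hge, hgX.eventually_nhds] with τ h1 h2 h3 h4
    have h5 := hasDerivAt_slice_snd ((ContDiffAt.fderiv_apply_const h1.1 (1, 0)).differentiableAt
      (by simp))
    exact h5.unique ((h3.hasDerivAt.smul h2).congr_of_eventuallyEq h4)
  have hW : HasDerivAt (fun τ => f (X (u, τ), Xt (u, τ)))
      (fderiv ℝ f (X (u, t), Xt (u, t)) (Xt (u, t), f (X (u, t), Xt (u, t)))) t :=
    hf.hasFDerivAt.comp_hasDerivAt t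
      ((hasDerivAt_slice_snd (hX.differentiableAt (by simp))).prodMk hxt.self_of_nhds)
  have hgd := hge.self_of_nhds.hasDerivAt
  have hgdd := (hg.deriv_of_infty.differentiableAt (by simp)).hasDerivAt
  -- First evaluation of `∂_t² ∂_u X`, by differentiating `g x'` twice: `g (x'')' + 2 g' f + g''
  -- x'`.
  have h1 := (hasDerivAt_slice_snd (hXut.differentiableAt (by simp))).unique
    (((hgd.smul hW).add (hgdd.smul hxt.self_of_nhds)).congr_of_eventuallyEq hz)
  have h2 := fderiv_variation hX hf h
  -- Second evaluation, by the linearized equation: its argument is `g (x', x'') + g' (0, x')`, and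
  -- Euler's relation turns the last summand into `2 g' f`. Comparison leaves `g'' x' = 0`.
  have h3 : ((Xu (u, t), fderiv ℝ Xu (u, t) (0, 1)) : E × E) =
      g t • (Xt (u, t), f (X (u, t), Xt (u, t))) + deriv g t • ((0 : E), Xt (u, t)) := by
    refine Prod.ext ?_ ?_
    · simpa using hgX.self_of_nhds
    · simpa using hz.self_of_nhds
  have h4 : fderiv ℝ f (X (u, t), Xt (u, t)) (Xu (u, t), fderiv ℝ Xu (u, t) (0, 1)) =
      g t • fderiv ℝ f (X (u, t), Xt (u, t)) (Xt (u, t), f (X (u, t), Xt (u, t))) +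
        deriv g t • (2 : ℝ) • f (X (u, t), Xt (u, t)) := by
    rw [h3, map_add, map_smul, map_smul, ← hf2]
  have h5 := h1.symm.trans (h2.trans h4)
  have h6 : deriv (deriv g) t • Xt (u, t) = 0 := by
    have h7 : deriv (deriv g) t • Xt (u, t) =
      (g t • fderiv ℝ f (X (u, t), Xt (u, t)) (Xt (u, t), f (X (u, t), Xt (u, t))) +
        deriv g t • f (X (u, t), Xt (u, t)) + (deriv g t • f (X (u, t), Xt (u, t)) +
        deriv (deriv g) t • Xt (u, t))) -
      (g t • fderiv ℝ f (X (u, t), Xt (u, t)) (Xt (u, t), f (X (u, t), Xt (u, t))) +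
        deriv g t • (2 : ℝ) • f (X (u, t), Xt (u, t))) := by module
    rw [h7, sub_eq_zero]
    exact h5
  exact (smul_eq_zero.1 h6).resolve_right h0

/-- Local uniqueness for the linearization of `x'' = f (x, x')`. -/
theorem exists_nhds_variation_eq_zero {X : ℝ × ℝ → E} {f : E × E → E} {u t : ℝ}
    (hX : ContDiffAt ℝ ∞ X (u, t)) (hf : ContDiffAt ℝ ∞ f (X (u, t), fderiv ℝ X (u, t) (0, 1)))
    (h : ∀ᶠ q in 𝓝 (u, t), ContDiffAt ℝ ∞ X q ∧
      fderiv ℝ (fun q => fderiv ℝ X q (0, 1)) q (0, 1) = f (X q, fderiv ℝ X q (0, 1))) :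
    ∃ W ∈ 𝓝 t, IsOpen W ∧ ∀ t' ∈ W, (∀ᶠ τ in 𝓝 t', fderiv ℝ X (u, τ) (1, 0) = 0) →
      ∀ τ ∈ W, fderiv ℝ X (u, τ) (1, 0) = 0 := by
  have hXt := ContDiffAt.fderiv_apply_const hX (0, 1)
  have hin : ContinuousAt (fun τ : ℝ => (u, τ)) t := by fun_prop
  set Xt : ℝ × ℝ → E := fun q => fderiv ℝ X q (0, 1) with hXtdef
  set Xu : ℝ × ℝ → E := fun q => fderiv ℝ X q (1, 0) with hXudef
  have hz : ContinuousAt (fun τ => (X (u, τ), Xt (u, τ))) t :=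
    ContinuousAt.comp (f := fun τ : ℝ => (u, τ)) (g := fun q => (X q, Xt q))
      (hX.continuousAt.prodMk hXt.continuousAt) hin
  let A : ℝ → E × E →L[ℝ] E := fun τ => fderiv ℝ f (X (u, τ), Xt (u, τ))
  have hA : ContinuousAt A t :=
    ContinuousAt.comp (g := fderiv ℝ f) (hf.continuousAt_fderiv (by simp)) hz
  have hfd : ∀ᶠ τ in 𝓝 t, DifferentiableAt ℝ f (X (u, τ), Xt (u, τ)) :=
    hz.eventually (((hf.of_le (m := 1) ENat.LEInfty.out).eventually (by simp)).mono
      fun z hz => hz.differentiableAt (by simp))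
  have hbd : ∀ᶠ τ in 𝓝 t, ‖A τ‖ < ‖A t‖ + 1 := hA.norm.eventually_lt continuousAt_const (by simp)
  have hev := (hin.eventually h.eventually_nhds).and (hfd.and hbd)
  obtain ⟨r, hr, hW⟩ := Metric.eventually_nhds_iff_ball.1 hev
  rw [Real.ball_eq_Ioo] at hW
  refine ⟨Ioo (t - r) (t + r), Ioo_mem_nhds (by linarith) (by linarith), isOpen_Ioo, ?_⟩
  intro t' ht' hzero
  -- The linearized equation as a first-order linear system for `(∂_u X, ∂_t ∂_u X)`.
  let v : ℝ → E × E → E × E := fun τ y => (y.2, A τ y)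
  let Y : ℝ → E × E := fun τ => (Xu (u, τ), fderiv ℝ Xu (u, τ) (0, 1))
  have hY : ∀ τ ∈ Ioo (t - r) (t + r), HasDerivAt Y (v τ (Y τ)) τ := by
    intro τ hτ
    have h1 := (hW τ hτ).1.self_of_nhds
    have hu := ContDiffAt.fderiv_apply_const h1.1 (1, 0)
    have h2 := hasDerivAt_slice_snd (hu.differentiableAt (by simp))
    have h3 := hasDerivAt_slice_snd ((ContDiffAt.fderiv_apply_const hu (0, 1)).differentiableAt
      (by simp))
    rw [fderiv_variation h1.1 (hW τ hτ).2.1 (hW τ hτ).1] at h3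
    exact h2.prodMk h3
  -- The `1` serves the component `y.2`, and `‖A t‖ + 1` bounds the coefficient `A τ` on the whole
  -- interval.
  have hlip : ∀ τ ∈ Ioo (t - r) (t + r),
      LipschitzOnWith (max 1 (‖A t‖₊ + 1)) (v τ) univ := by
    intro τ hτ
    rw [lipschitzOnWith_univ]
    refine (LipschitzWith.prod_snd (α := E) (β := E)).prodMk ((A τ).lipschitz.weaken ?_)
    exact (hW τ hτ).2.2.le
  have hY0 : Y t' = 0 := by
    have h1 := (hW t' ht').1.self_of_nhds
    have h2 := hasDerivAt_slice_snd ((ContDiffAt.fderiv_apply_const h1.1 (1, 0)).differentiableAt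
      (by simp))
    refine Prod.ext hzero.self_of_nhds ?_
    exact h2.unique ((hasDerivAt_const t' (0 : E)).congr_of_eventuallyEq hzero)
  have := ODE_solution_unique_of_mem_Ioo (g := fun _ => (0 : E × E)) hlip ht'
    (fun τ hτ => ⟨hY τ hτ, mem_univ _⟩)
    (fun τ hτ => ⟨(hasDerivAt_const τ (0 : E × E)).congr_deriv (by simp [v]; rfl), mem_univ _⟩) hY0
  exact fun τ hτ => congrArg Prod.fst (this hτ)

end Variation

/-! ### Families of geodesics on the manifold and their variation fields. -/

section Families

open Filter Topology

variable {E : Type*} [NormedAddCommGroup E] [NormedSpace ℝ E]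
  {M : Type*} [TopologicalSpace M] [ChartedSpace E M]
  {γ : ℝ → ℝ → M} {U I : Set ℝ} {p : M}

theorem contMDiffAt_slice_snd {u t : ℝ}
    (hγ : ContMDiffAt 𝓘(ℝ, ℝ × ℝ) 𝓘(ℝ, E) ∞ (fun q : ℝ × ℝ => γ q.1 q.2) (u, t)) :
    ContMDiffAt 𝓘(ℝ, ℝ) 𝓘(ℝ, E) ∞ (γ u) t :=
  ContMDiffAt.comp (I' := 𝓘(ℝ, ℝ × ℝ)) (g := fun q : ℝ × ℝ => γ q.1 q.2)
    (f := fun τ : ℝ => (u, τ)) t hγ (ContDiffAt.contMDiffAt (by fun_prop))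

theorem contMDiffAt_slice_fst {u t : ℝ}
    (hγ : ContMDiffAt 𝓘(ℝ, ℝ × ℝ) 𝓘(ℝ, E) ∞ (fun q : ℝ × ℝ => γ q.1 q.2) (u, t)) :
    ContMDiffAt 𝓘(ℝ, ℝ) 𝓘(ℝ, E) ∞ (fun u => γ u t) u :=
  ContMDiffAt.comp (I' := 𝓘(ℝ, ℝ × ℝ)) (g := fun q : ℝ × ℝ => γ q.1 q.2)
    (f := fun u : ℝ => (u, t)) u hγ (ContDiffAt.contMDiffAt (by fun_prop))

theorem eventually_mem_chart_source
    (hU : IsOpen U) (hI : IsOpen I)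
    (hγ : ContMDiffOn 𝓘(ℝ, ℝ × ℝ) 𝓘(ℝ, E) ∞ (fun q : ℝ × ℝ => γ q.1 q.2) (U ×ˢ I))
    {q : ℝ × ℝ} (hq : q ∈ U ×ˢ I) (hp : γ q.1 q.2 ∈ (chartAt E p).source) :
    ∀ᶠ r in 𝓝 q, r ∈ U ×ˢ I ∧ γ r.1 r.2 ∈ (chartAt E p).source := by
  have hc := (hγ.contMDiffAt ((hU.prod hI).mem_nhds hq)).continuousAt
  exact ((hU.prod hI).eventually_mem hq).and
    (hc.eventually_mem ((chartAt E p).open_source.mem_nhds hp))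

variable [IsManifold 𝓘(ℝ, E) ∞ M]
  {S : (v : TangentBundle 𝓘(ℝ, E) M) → TangentSpace 𝓘(ℝ, E).tangent v}

theorem contDiffAt_coordFamily {q : ℝ × ℝ}
    (hγ : ContMDiffAt 𝓘(ℝ, ℝ × ℝ) 𝓘(ℝ, E) ∞ (fun q : ℝ × ℝ => γ q.1 q.2) q)
    (hp : γ q.1 q.2 ∈ (chartAt E p).source) :
    ContDiffAt ℝ ∞ (fun q : ℝ × ℝ => extChartAt 𝓘(ℝ, E) p (γ q.1 q.2)) q :=
  ((contMDiffAt_extChartAt' hp).comp q hγ).contDiffAt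

theorem tangentChart_velocity_slice_snd {q : ℝ × ℝ}
    (hγ : ContMDiffAt 𝓘(ℝ, ℝ × ℝ) 𝓘(ℝ, E) ∞ (fun q : ℝ × ℝ => γ q.1 q.2) q)
    (hp : γ q.1 q.2 ∈ (chartAt E p).source) :
    tangentChart p (velocity (γ q.1) q.2 : TangentBundle 𝓘(ℝ, E) M) =
      (extChartAt 𝓘(ℝ, E) p (γ q.1 q.2),
        fderiv ℝ (fun q : ℝ × ℝ => extChartAt 𝓘(ℝ, E) p (γ q.1 q.2)) q (0, 1)) := by
  rw [tangentChart_velocity ((contMDiffAt_slice_snd hγ).mdifferentiableAt (by simp)) hp]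
  exact Prod.ext rfl
    (hasDerivAt_slice_snd ((contDiffAt_coordFamily hγ hp).differentiableAt (by simp))).deriv

theorem tangentChart_velocity_slice_fst {q : ℝ × ℝ}
    (hγ : ContMDiffAt 𝓘(ℝ, ℝ × ℝ) 𝓘(ℝ, E) ∞ (fun q : ℝ × ℝ => γ q.1 q.2) q)
    (hp : γ q.1 q.2 ∈ (chartAt E p).source) :
    tangentChart p (velocity (fun u => γ u q.2) q.1 : TangentBundle 𝓘(ℝ, E) M) =
      (extChartAt 𝓘(ℝ, E) p (γ q.1 q.2),
        fderiv ℝ (fun q : ℝ × ℝ => extChartAt 𝓘(ℝ, E) p (γ q.1 q.2)) q (1, 0)) := by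
  rw [tangentChart_velocity (c := fun u => γ u q.2)
    ((contMDiffAt_slice_fst hγ).mdifferentiableAt (by simp)) hp]
  exact Prod.ext rfl
    (hasDerivAt_slice_fst ((contDiffAt_coordFamily hγ hp).differentiableAt (by simp))).deriv

theorem velocity_slice_fst_mem_slit_iff {q : ℝ × ℝ}
    (hγ : ContMDiffAt 𝓘(ℝ, ℝ × ℝ) 𝓘(ℝ, E) ∞ (fun q : ℝ × ℝ => γ q.1 q.2) q)
    (hp : γ q.1 q.2 ∈ (chartAt E p).source) :
    velocity (fun u => γ u q.2) q.1 ∈ slit E M ↔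
      fderiv ℝ (fun q : ℝ × ℝ => extChartAt 𝓘(ℝ, E) p (γ q.1 q.2)) q (1, 0) ≠ 0 := by
  rw [mem_slit_iff (p := p) (v := velocity (fun u => γ u q.2) q.1) hp,
    tangentChart_velocity_slice_fst hγ hp]

/-- In a chart the velocity is `(X, ∂X/∂t)`, smooth in both variables, and regularity keeps it in
the slit bundle, where `P` is smooth. -/
theorem contDiffOn_comp_velocity (hU : IsOpen U) (hI : IsOpen I)
    (hγ : ContMDiffOn 𝓘(ℝ, ℝ × ℝ) 𝓘(ℝ, E) ∞ (fun q : ℝ × ℝ => γ q.1 q.2) (U ×ˢ I))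
    (h0 : ∀ q ∈ U ×ˢ I, velocity (γ q.1) q.2 ∈ slit E M)
    {P : TangentBundle 𝓘(ℝ, E) M → ℝ}
    (hP : ContMDiffOn 𝓘(ℝ, E).tangent 𝓘(ℝ, ℝ) ∞ P (slit E M)) :
    ContDiffOn ℝ ∞ (fun q : ℝ × ℝ => P (velocity (γ q.1) q.2)) (U ×ˢ I) := by
  intro q hq
  have hp := mem_chart_source E (γ q.1 q.2)
  set p := γ q.1 q.2
  have hev := eventually_mem_chart_source hU hI hγ hq hp
  set X : ℝ × ℝ → E := fun q => extChartAt 𝓘(ℝ, E) p (γ q.1 q.2)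
  have hc : ∀ r, r ∈ U ×ˢ I ∧ γ r.1 r.2 ∈ (chartAt E p).source →
      tangentChart p (velocity (γ r.1) r.2 : TangentBundle 𝓘(ℝ, E) M) =
        (X r, fderiv ℝ X r (0, 1)) := fun r hr =>
    tangentChart_velocity_slice_snd (hγ.contMDiffAt ((hU.prod hI).mem_nhds hr.1)) hr.2
  have hs : ∀ r, r ∈ U ×ˢ I ∧ γ r.1 r.2 ∈ (chartAt E p).source →
      (velocity (γ r.1) r.2 : TangentBundle 𝓘(ℝ, E) M) ∈ (tangentChart p).source := fun r hr =>
    mem_tangentChart_source.2 hr.2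
  have hX : ContDiffAt ℝ ∞ X q :=
    contDiffAt_coordFamily (hγ.contMDiffAt ((hU.prod hI).mem_nhds hq)) hp
  have h1 : ContMDiffAt 𝓘(ℝ, ℝ × ℝ) 𝓘(ℝ, E × E) ∞ (fun r => (X r, fderiv ℝ X r (0, 1))) q :=
    (hX.prodMk (hX.fderiv_apply_const (0, 1))).contMDiffAt
  have hz : (X q, fderiv ℝ X q (0, 1)) ∈ (tangentChart p).target := by
    rw [← hc q ⟨hq, hp⟩]
    exact (tangentChart p).map_source (hs q ⟨hq, hp⟩)
  have hzs : (tangentChart p).symm (X q, fderiv ℝ X q (0, 1)) ∈ slit E M := by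
    rw [← hc q ⟨hq, hp⟩, (tangentChart p).left_inv (hs q ⟨hq, hp⟩)]
    exact h0 q hq
  have h2 : ContMDiffAt 𝓘(ℝ, ℝ × ℝ) 𝓘(ℝ, ℝ) ∞
      (fun r => P ((tangentChart p).symm (X r, fderiv ℝ X r (0, 1)))) q :=
    ContMDiffAt.comp (I' := 𝓘(ℝ, E).tangent) (g := P) q
      (hP.contMDiffAt (isOpen_slit.mem_nhds hzs))
      (ContMDiffAt.comp (I' := 𝓘(ℝ, E × E)) q ((contMDiffOn_tangentChart_symm p).contMDiffAt
        ((isOpen_tangentChart_target p).mem_nhds hz)) h1)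
  refine (h2.contDiffAt.congr_of_eventuallyEq ?_).contDiffWithinAt
  filter_upwards [hev] with r hr
  rw [← hc r hr, (tangentChart p).left_inv (hs r hr)]

theorem coordFamily_geodesicEquation (hS : IsSpray S) (hU : IsOpen U) (hI : IsOpen I)
    (hγ : ContMDiffOn 𝓘(ℝ, ℝ × ℝ) 𝓘(ℝ, E) ∞ (fun q : ℝ × ℝ => γ q.1 q.2) (U ×ˢ I))
    (hgeo : ∀ u ∈ U, IsGeodesicOn S (γ u) I)
    {q : ℝ × ℝ} (hq : q ∈ U ×ˢ I) (hp : γ q.1 q.2 ∈ (chartAt E p).source) :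
    fderiv ℝ (fun q => fderiv ℝ (fun q : ℝ × ℝ => extChartAt 𝓘(ℝ, E) p (γ q.1 q.2)) q (0, 1))
        q (0, 1) = force p S (extChartAt 𝓘(ℝ, E) p (γ q.1 q.2),
          fderiv ℝ (fun q : ℝ × ℝ => extChartAt 𝓘(ℝ, E) p (γ q.1 q.2)) q (0, 1)) := by
  obtain ⟨u, t⟩ := q
  have hsm : ∀ r ∈ U ×ˢ I, ContMDiffAt 𝓘(ℝ, ℝ × ℝ) 𝓘(ℝ, E) ∞ (fun q : ℝ × ℝ => γ q.1 q.2) r :=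
    fun r hr => hγ.contMDiffAt ((hU.prod hI).mem_nhds hr)
  have h1 := (hgeo u hq.1).deriv_deriv_eq hS hI hq.2 hp
  rw [tangentChart_velocity_slice_snd (hsm _ hq) hp] at h1
  rw [← h1]
  have hin : ContinuousAt (fun τ : ℝ => (u, τ)) t := by fun_prop
  have h2 : deriv (fun τ => extChartAt 𝓘(ℝ, E) p (γ u τ)) =ᶠ[𝓝 t]
      fun τ => fderiv ℝ (fun q : ℝ × ℝ => extChartAt 𝓘(ℝ, E) p (γ q.1 q.2)) (u, τ) (0, 1) := by
    filter_upwards [hin.eventually (eventually_mem_chart_source hU hI hγ hq hp)] with τ hτ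
    exact (hasDerivAt_slice_snd
      ((contDiffAt_coordFamily (hsm _ hτ.1) hτ.2).differentiableAt (by simp))).deriv
  rw [h2.deriv_eq]
  exact (hasDerivAt_slice_snd (((contDiffAt_coordFamily (hsm _ hq) hp).fderiv_apply_const
    (0, 1)).differentiableAt (by simp))).deriv.symm

theorem eventually_coordFamily_geodesicEquation (hS : IsSpray S) (hU : IsOpen U) (hI : IsOpen I)
    (hγ : ContMDiffOn 𝓘(ℝ, ℝ × ℝ) 𝓘(ℝ, E) ∞ (fun q : ℝ × ℝ => γ q.1 q.2) (U ×ˢ I))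
    (hgeo : ∀ u ∈ U, IsGeodesicOn S (γ u) I)
    {q : ℝ × ℝ} (hq : q ∈ U ×ˢ I) (hp : γ q.1 q.2 ∈ (chartAt E p).source) :
    ∀ᶠ q in 𝓝 q, ContDiffAt ℝ ∞ (fun q : ℝ × ℝ => extChartAt 𝓘(ℝ, E) p (γ q.1 q.2)) q ∧
      fderiv ℝ (fun q => fderiv ℝ (fun q : ℝ × ℝ => extChartAt 𝓘(ℝ, E) p (γ q.1 q.2)) q (0, 1))
        q (0, 1) = force p S (extChartAt 𝓘(ℝ, E) p (γ q.1 q.2),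
          fderiv ℝ (fun q : ℝ × ℝ => extChartAt 𝓘(ℝ, E) p (γ q.1 q.2)) q (0, 1)) :=
  (eventually_mem_chart_source hU hI hγ hq hp).mono fun _ hr =>
    ⟨contDiffAt_coordFamily (hγ.contMDiffAt ((hU.prod hI).mem_nhds hr.1)) hr.2,
      coordFamily_geodesicEquation hS hU hI hγ hgeo hr.1 hr.2⟩

theorem coordFamily_fderiv_ne_zero (hU : IsOpen U) (hI : IsOpen I)
    (hγ : ContMDiffOn 𝓘(ℝ, ℝ × ℝ) 𝓘(ℝ, E) ∞ (fun q : ℝ × ℝ => γ q.1 q.2) (U ×ˢ I))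
    (hgeo : ∀ u ∈ U, IsGeodesicOn S (γ u) I)
    {q : ℝ × ℝ} (hq : q ∈ U ×ˢ I) (hp : γ q.1 q.2 ∈ (chartAt E p).source) :
    fderiv ℝ (fun q : ℝ × ℝ => extChartAt 𝓘(ℝ, E) p (γ q.1 q.2)) q (0, 1) ≠ 0 := by
  have h1 := (mem_slit_iff (p := p) (v := velocity (γ q.1) q.2) hp).1 ((hgeo _ hq.1).regular _ hq.2)
  rwa [tangentChart_velocity_slice_snd (hγ.contMDiffAt ((hU.prod hI).mem_nhds hq)) hp] at h1

variable [FiniteDimensional ℝ E]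

/-- A Jacobi field that vanishes near one parameter vanishes identically. -/
theorem velocity_notMem_slit_of_eventually (hS : IsSpray S) (hU : IsOpen U) (hI : IsOpen I)
    (hI' : I.OrdConnected)
    (hγ : ContMDiffOn 𝓘(ℝ, ℝ × ℝ) 𝓘(ℝ, E) ∞ (fun q : ℝ × ℝ => γ q.1 q.2) (U ×ˢ I))
    (hgeo : ∀ u ∈ U, IsGeodesicOn S (γ u) I) {u : ℝ} (hu : u ∈ U) {t₀ : ℝ} (ht₀ : t₀ ∈ I)
    (h : ∀ᶠ t in 𝓝 t₀, velocity (fun u => γ u t) u ∉ slit E M) {t : ℝ} (ht : t ∈ I) :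
    velocity (fun u => γ u t) u ∉ slit E M := by
  -- The interior of the zero set of the field. It is open, and local uniqueness shows that it is
  -- relatively closed in `I`, so connectedness gives all of `I`.
  let Z : Set ℝ := {t | ∀ᶠ τ in 𝓝 t, velocity (fun u => γ u τ) u ∉ slit E M}
  have hZ : IsOpen Z := isOpen_setOfPred_eventually_nhds
  suffices hsub : I ⊆ Z from (hsub ht : ∀ᶠ τ in 𝓝 t, _).self_of_nhds
  refine hI'.isPreconnected.subset_of_closure_inter_subset hZ ⟨t₀, ht₀, h⟩ ?_
  rintro r ⟨hr, hrI⟩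
  have hq : (u, r) ∈ U ×ˢ I := ⟨hu, hrI⟩
  have hp := mem_chart_source E (γ u r)
  set p := γ u r
  have hX := contDiffAt_coordFamily (hγ.contMDiffAt ((hU.prod hI).mem_nhds hq)) hp
  obtain ⟨W, hW, hWo, hWz⟩ := exists_nhds_variation_eq_zero hX
    (hS.contDiffAt_force ((chartAt E p).map_source hp)
      (coordFamily_fderiv_ne_zero hU hI hγ hgeo hq hp))
    (eventually_coordFamily_geodesicEquation hS hU hI hγ hgeo hq hp)
  have hin : ContinuousAt (fun τ : ℝ => (u, τ)) r := by fun_prop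
  have hiff : ∀ᶠ τ in 𝓝 r, (velocity (fun u => γ u τ) u ∉ slit E M ↔
      fderiv ℝ (fun q : ℝ × ℝ => extChartAt 𝓘(ℝ, E) p (γ q.1 q.2)) (u, τ) (1, 0) = 0) := by
    filter_upwards [hin.eventually (eventually_mem_chart_source hU hI hγ hq hp)] with τ hτ
    rw [velocity_slice_fst_mem_slit_iff (q := (u, τ))
      (hγ.contMDiffAt ((hU.prod hI).mem_nhds hτ.1)) hτ.2, not_not]
  -- The point `r` is only a limit of `Z`, so uniqueness on `W` is started from a nearby `t'` in
  -- `Z`.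
  obtain ⟨t', ht'Z, ht'W, ht'⟩ := ((mem_closure_iff_frequently.1 hr).and_eventually
    ((show ∀ᶠ τ in 𝓝 r, τ ∈ W from hW).and hiff.eventually_nhds)).exists
  have h1 := hWz t' ht'W (((ht'Z : ∀ᶠ τ in 𝓝 t', _).and ht').mono fun τ hτ => hτ.2.1 hτ.1)
  filter_upwards [hW, hiff] with τ hτ hτ'
  exact hτ'.2 (h1 τ hτ)

/-- A tangential Jacobi field `g • ċ` has `g'' = 0`. -/
theorem deriv_deriv_eq_zero_of_tangential_family (hS : IsSpray S) (hU : IsOpen U) (hI : IsOpen I)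
    (hγ : ContMDiffOn 𝓘(ℝ, ℝ × ℝ) 𝓘(ℝ, E) ∞ (fun q : ℝ × ℝ => γ q.1 q.2) (U ×ˢ I))
    (hgeo : ∀ u ∈ U, IsGeodesicOn S (γ u) I) {u : ℝ} (hu : u ∈ U) {t : ℝ} (ht : t ∈ I)
    {g : ℝ → ℝ} (hg : ContDiffAt ℝ ∞ g t)
    (hgγ : ∀ᶠ τ in 𝓝 t, ∀ p : M, γ u τ ∈ (chartAt E p).source →
      fderiv ℝ (fun q : ℝ × ℝ => extChartAt 𝓘(ℝ, E) p (γ q.1 q.2)) (u, τ) (1, 0) =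
        g τ • fderiv ℝ (fun q : ℝ × ℝ => extChartAt 𝓘(ℝ, E) p (γ q.1 q.2)) (u, τ) (0, 1)) :
    deriv (deriv g) t = 0 := by
  have hq : (u, t) ∈ U ×ˢ I := ⟨hu, ht⟩
  have hp := mem_chart_source E (γ u t)
  set p := γ u t
  have hX := contDiffAt_coordFamily (hγ.contMDiffAt ((hU.prod hI).mem_nhds hq)) hp
  have hne := coordFamily_fderiv_ne_zero hU hI hγ hgeo hq hp
  have hxt : (extChartAt 𝓘(ℝ, E) p (γ u t)) ∈ (chartAt E p).target := (chartAt E p).map_source hp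
  have hin : ContinuousAt (fun τ : ℝ => (u, τ)) t := by fun_prop
  refine deriv_deriv_eq_zero_of_tangential hX hne
    ((hS.contDiffAt_force hxt hne).differentiableAt (by simp)) (hS.fderiv_force hxt hne)
    (eventually_coordFamily_geodesicEquation hS hU hI hγ hgeo hq hp) hg ?_
  filter_upwards [hgγ, hin.eventually (eventually_mem_chart_source hU hI hγ hq hp)] with τ h1 h2
  exact h1 p h2.2

end Families

/-! ### Solving `F'' = 2 p F'` with parameters and boundary values. -/

section ProjectiveParameter

variable {p : ℝ × ℝ → ℝ} {U I : Set ℝ} {t₀ : ℝ}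

/-- A solution `F` of `F'' = 2 p F'`, with `F = 0` and `F' = 1` at `t₀`; it depends on a parameter,
which is the first variable. -/
def projectiveParameter (p : ℝ × ℝ → ℝ) (t₀ : ℝ) (q : ℝ × ℝ) : ℝ :=
  ∫ τ in t₀..q.2, Real.exp (2 * ∫ σ in t₀..τ, p (q.1, σ))

theorem projectiveParameter_self (u : ℝ) : projectiveParameter p t₀ (u, t₀) = 0 := by
  simp [projectiveParameter]

theorem contDiffOn_projectiveParameter (hU : IsOpen U) (hI : IsOpen I) (hI' : I.OrdConnected)
    (hp : ContDiffOn ℝ ∞ p (U ×ˢ I)) (ht₀ : t₀ ∈ I) :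
    ContDiffOn ℝ ∞ (projectiveParameter p t₀) (U ×ˢ I) :=
  contDiffOn_parametric_primitive hU hI hI' (p := fun q => Real.exp (2 * ∫ σ in t₀..q.2, p (q.1, σ)))
    (contDiffOn_const.mul (contDiffOn_parametric_primitive hU hI hI' hp ht₀)).exp ht₀

theorem hasDerivAt_integral_slice (hI : IsOpen I) (hI' : I.OrdConnected)
    (hp : ContDiffOn ℝ ∞ p (U ×ˢ I)) (ht₀ : t₀ ∈ I) {u t : ℝ} (hu : u ∈ U) (ht : t ∈ I) :
    HasDerivAt (fun t => ∫ σ in t₀..t, p (u, σ)) (p (u, t)) t :=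
  hasDerivAt_primitive_right hI hI' (f := fun t => p (u, t))
    (hp.continuousOn.comp (by fun_prop) fun _ hτ => ⟨hu, hτ⟩) ht₀ ht

theorem hasDerivAt_projectiveParameter (hI : IsOpen I) (hI' : I.OrdConnected)
    (hp : ContDiffOn ℝ ∞ p (U ×ˢ I)) (ht₀ : t₀ ∈ I) {u t : ℝ} (hu : u ∈ U) (ht : t ∈ I) :
    HasDerivAt (fun t => projectiveParameter p t₀ (u, t))
      (Real.exp (2 * ∫ σ in t₀..t, p (u, σ))) t :=
  hasDerivAt_primitive_right hI hI' (f := fun t => Real.exp (2 * ∫ σ in t₀..t, p (u, σ)))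
    (fun _ ht => ((hasDerivAt_integral_slice hI hI' hp ht₀ hu ht).const_mul
      2).exp.continuousAt.continuousWithinAt) ht₀ ht

theorem fderiv_projectiveParameter (hU : IsOpen U) (hI : IsOpen I) (hI' : I.OrdConnected)
    (hp : ContDiffOn ℝ ∞ p (U ×ˢ I)) (ht₀ : t₀ ∈ I) {q : ℝ × ℝ} (hq : q ∈ U ×ˢ I) :
    fderiv ℝ (projectiveParameter p t₀) q (0, 1) =
      Real.exp (2 * ∫ σ in t₀..q.2, p (q.1, σ)) :=
  (hasDerivAt_slice_snd (((contDiffOn_projectiveParameter hU hI hI' hp ht₀).contDiffAt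
    ((hU.prod hI).mem_nhds hq)).differentiableAt (by simp))).unique
    (hasDerivAt_projectiveParameter hI hI' hp ht₀ hq.1 hq.2)

theorem strictMonoOn_projectiveParameter (hU : IsOpen U) (hI : IsOpen I) (hI' : I.OrdConnected)
    (hp : ContDiffOn ℝ ∞ p (U ×ˢ I)) (ht₀ : t₀ ∈ I) {u : ℝ} (hu : u ∈ U) :
    StrictMonoOn (fun t => projectiveParameter p t₀ (u, t)) I :=
  strictMonoOn_of_fderiv_pos hU hI hI' (contDiffOn_projectiveParameter hU hI hI' hp ht₀)
    (fun q hq => by rw [fderiv_projectiveParameter hU hI hI' hp ht₀ hq]; exact Real.exp_pos _) hu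

/-- A smooth family of solutions of `F'' = 2 p F'` with prescribed values at two parameters. -/
theorem exists_projectiveParameter_of_boundary (hU : IsOpen U) (hI : IsOpen I)
    (hI' : I.OrdConnected) (hp : ContDiffOn ℝ ∞ p (U ×ˢ I)) (ht₀ : t₀ ∈ I) {t₁ : ℝ} (ht₁ : t₁ ∈ I)
    {s₀ s₁ : ℝ} (h : s₀ < s₁ ∧ t₀ < t₁ ∨ s₁ < s₀ ∧ t₁ < t₀) :
    ∃ F : ℝ × ℝ → ℝ, ContDiffOn ℝ ∞ F (U ×ˢ I) ∧ (∀ q ∈ U ×ˢ I, 0 < fderiv ℝ F q (0, 1)) ∧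
      (∀ u ∈ U, F (u, t₀) = s₀ ∧ F (u, t₁) = s₁) ∧ ∀ u ∈ U, ∃ k, 0 < k ∧ ∀ t ∈ I,
        HasDerivAt (fun t => F (u, t)) (k * Real.exp (2 * ∫ σ in t₀..t, p (u, σ))) t := by
  set A := projectiveParameter p t₀
  have hA := contDiffOn_projectiveParameter hU hI hI' hp ht₀
  -- Since `A (u, ·)` increases from `0` at `t₀`, the sign of `A (u, t₁)` is that of `t₁ - t₀`,
  -- hence that of `s₁ - s₀`.
  have hA1 : ∀ u ∈ U, 0 < (s₁ - s₀) / A (u, t₁) := by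
    intro u hu
    have hm := strictMonoOn_projectiveParameter hU hI hI' hp ht₀ hu
    have h0 : A (u, t₀) = 0 := projectiveParameter_self u
    rcases h with h | h
    · have : A (u, t₀) < A (u, t₁) := hm ht₀ ht₁ h.2
      exact div_pos (by linarith) (by linarith)
    · have : A (u, t₁) < A (u, t₀) := hm ht₁ ht₀ h.2
      exact div_pos_of_neg_of_neg (by linarith) (by linarith)
  have hA0 : ∀ u ∈ U, A (u, t₁) ≠ 0 := fun u hu h0 => by
    have := hA1 u hu
    rw [h0, div_zero] at this
    exact lt_irrefl _ this
  have hF : ContDiffOn ℝ ∞ (fun q : ℝ × ℝ => s₀ + (s₁ - s₀) / A (q.1, t₁) * A q) (U ×ˢ I) := by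
    refine contDiffOn_const.add (ContDiffOn.mul (contDiffOn_const.div ?_ ?_) hA)
    · exact hA.comp (g := A) (f := fun q : ℝ × ℝ => (q.1, t₁)) (by fun_prop)
        fun q hq => ⟨hq.1, ht₁⟩
    · exact fun q hq => hA0 _ hq.1
  have hd : ∀ u ∈ U, ∀ t ∈ I,
      HasDerivAt (fun t => s₀ + (s₁ - s₀) / A (u, t₁) * A (u, t))
        ((s₁ - s₀) / A (u, t₁) * Real.exp (2 * ∫ σ in t₀..t, p (u, σ))) t := fun u hu t ht =>
    ((hasDerivAt_projectiveParameter hI hI' hp ht₀ hu ht).const_mul _).const_add _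
  refine ⟨_, hF, fun q hq => ?_, fun u hu => ⟨?_, ?_⟩, fun u hu => ⟨_, hA1 u hu, hd u hu⟩⟩
  · rw [(hasDerivAt_slice_snd ((hF.contDiffAt ((hU.prod hI).mem_nhds hq)).differentiableAt
      (by simp))).unique (hd q.1 hq.1 q.2 hq.2)]
    exact mul_pos (hA1 _ hq.1) (Real.exp_pos _)
  · have h0 : A (u, t₀) = 0 := projectiveParameter_self u
    simp [h0]
  · have := hA0 u hu
    field_simp
    ring

end ProjectiveParameter

/-! ### Inverse parameter transformations. -/

section Reparametrizations

variable {θ : ℝ → ℝ} {I I' : Set ℝ}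

theorem IsReparametrization.strictMonoOn (h : IsReparametrization θ I' I) :
    StrictMonoOn θ I' :=
  strictMonoOn_of_deriv_pos h.ordConnected.convex h.smooth.continuousOn fun s hs =>
    h.deriv_pos s (interior_subset hs)

theorem IsReparametrization.exists_inverse (h : IsReparametrization θ I' I) (hI : IsOpen I)
    (hI' : I.OrdConnected) :
    ∃ η : ℝ → ℝ, IsReparametrization η I I' ∧ ∀ s ∈ I', η (θ s) = s := by
  -- A single function is inverted as a family constant in its parameter; the slice at `0` is used
  -- below.
  have hF : ContDiffOn ℝ ∞ (fun q : ℝ × ℝ => θ q.2) (univ ×ˢ I') :=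
    h.smooth.comp contDiff_snd.contDiffOn fun q hq => hq.2
  have hθ : ∀ s ∈ I', HasDerivAt θ (deriv θ s) s := fun s hs =>
    ((h.smooth.contDiffAt (h.isOpen.mem_nhds hs)).differentiableAt (by simp)).hasDerivAt
  have hF0 : ∀ q ∈ (univ : Set ℝ) ×ˢ I', 0 < fderiv ℝ (fun q : ℝ × ℝ => θ q.2) q (0, 1) := by
    intro q hq
    rw [(hasDerivAt_slice_snd ((hF.contDiffAt ((isOpen_univ.prod h.isOpen).mem_nhds
      hq)).differentiableAt (by simp))).unique (hθ q.2 hq.2)]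
    exact h.deriv_pos _ hq.2
  obtain ⟨Θ, -, hΘ, hΘF⟩ := exists_contDiffOn_inverse_family isOpen_univ h.isOpen h.ordConnected
    hF hF0
  have hinv : ∀ s ∈ I', Θ (0, θ s) = s := fun s hs => hΘF (0, s) ⟨mem_univ _, hs⟩
  have hsm : ContDiffOn ℝ ∞ (fun t => Θ (0, t)) I := by
    refine hΘ.comp (f := fun t : ℝ => ((0 : ℝ), t)) (by fun_prop) fun t ht => ?_
    rw [← h.image_eq] at ht
    obtain ⟨s, hs, rfl⟩ := ht
    exact ⟨(0, s), ⟨mem_univ _, hs⟩, rfl⟩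
  refine ⟨fun t => Θ (0, t), ⟨hI, hI', hsm, ?_, ?_⟩, hinv⟩
  · intro t ht
    have hd := ((hsm.contDiffAt (hI.mem_nhds ht)).differentiableAt (by simp)).hasDerivAt
    rw [← h.image_eq] at ht
    obtain ⟨s, hs, rfl⟩ := ht
    have h1 := hd.comp s (hθ s hs)
    have h2 := h1.unique ((hasDerivAt_id s).congr_of_eventuallyEq
      (Filter.eventually_of_mem (h.isOpen.mem_nhds hs) hinv))
    exact pos_of_mul_pos_left (by rw [h2]; exact one_pos) (h.deriv_pos s hs).le
  · rw [← h.image_eq, image_image]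
    exact (image_congr hinv).trans (image_id _)

end Reparametrizations

/-! ### Existence of the reparametrization. -/

section Existence

variable {E : Type*} [NormedAddCommGroup E] [NormedSpace ℝ E]
  {M : Type*} [TopologicalSpace M] [ChartedSpace E M] [IsManifold 𝓘(ℝ, E) ∞ M]
  {S S' : (v : TangentBundle 𝓘(ℝ, E) M) → TangentSpace 𝓘(ℝ, E).tangent v}

theorem ProjectivelyRelated.symm (h : ProjectivelyRelated S S') : ProjectivelyRelated S' S := by
  obtain ⟨P, hP, hP1, hP2⟩ := h
  refine ⟨-P, hP.neg, fun v hv r hr => ?_, fun v hv => ?_⟩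
  · simp [hP1 v hv r hr]
  · rw [hP2 v hv]
    simp

variable [FiniteDimensional ℝ E]

/-- The new parameter `f` is the solution of `f'' = 2 P(ċ) f'` with `f t₀ = 0`. It exists on all of
`I`, and `θ` is its inverse on `f '' I`. -/
theorem ProjectivelyRelated.exists_isReparametrization (h : ProjectivelyRelated S S')
    (hS : IsSpray S) (hS' : IsSpray S') {c : ℝ → M} {I : Set ℝ} (hI : IsOpen I)
    (hI' : I.OrdConnected) (hc : IsGeodesicOn S c I) {t₀ : ℝ} (ht₀ : t₀ ∈ I) :
    ∃ (I' : Set ℝ) (θ : ℝ → ℝ), IsReparametrization θ I' I ∧ 0 ∈ I' ∧ θ 0 = t₀ ∧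
      IsGeodesicOn S' (c ∘ θ) I' := by
  obtain ⟨P, hP, hP1, hP2⟩ := h
  let p : ℝ × ℝ → ℝ := fun q => P (velocity c q.2)
  have hγ : ContMDiffOn 𝓘(ℝ, ℝ × ℝ) 𝓘(ℝ, E) ∞ (fun q : ℝ × ℝ => c q.2) (univ ×ˢ I) :=
    hc.smooth.comp (I' := 𝓘(ℝ, ℝ)) (g := c) (f := Prod.snd)
      (contDiff_snd.contMDiff.contMDiffOn) fun q hq => hq.2
  have hp : ContDiffOn ℝ ∞ p (univ ×ˢ I) :=
    contDiffOn_comp_velocity (γ := fun _ => c) isOpen_univ hI hγ (fun q hq => hc.regular _ hq.2) hP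
  have hF := contDiffOn_projectiveParameter isOpen_univ hI hI' hp ht₀
  obtain ⟨Θ, hV, hΘ, hΘF⟩ := exists_contDiffOn_inverse_family isOpen_univ hI hI' hF
    fun q hq => by
      rw [fderiv_projectiveParameter isOpen_univ hI hI' hp ht₀ hq]
      exact Real.exp_pos _
  let f : ℝ → ℝ := fun t => projectiveParameter p t₀ (0, t)
  let θ : ℝ → ℝ := fun s => Θ (0, s)
  have hθf : ∀ t ∈ I, θ (f t) = t := fun t ht => hΘF (0, t) ⟨mem_univ _, ht⟩
  have hfd : ∀ t ∈ I, HasDerivAt f (1 * Real.exp (2 * ∫ σ in t₀..t, p (0, σ))) t := fun t ht => by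
    rw [one_mul]
    exact hasDerivAt_projectiveParameter hI hI' hp ht₀ (mem_univ 0) ht
  have hmem : ∀ s, s ∈ f '' I ↔
      ((0 : ℝ), s) ∈ (fun q : ℝ × ℝ => (q.1, projectiveParameter p t₀ q)) '' (univ ×ˢ I) := by
    intro s
    constructor
    · rintro ⟨t, ht, rfl⟩
      exact ⟨(0, t), ⟨mem_univ _, ht⟩, rfl⟩
    · rintro ⟨⟨u, t⟩, ⟨-, ht⟩, hq⟩
      obtain ⟨rfl, hq⟩ := Prod.mk.inj hq
      exact ⟨t, ht, hq⟩
  have hopen : IsOpen (f '' I) := by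
    rw [show f '' I = (fun s : ℝ => ((0 : ℝ), s)) ⁻¹' ((fun q : ℝ × ℝ =>
      (q.1, projectiveParameter p t₀ q)) '' (univ ×ˢ I)) from Set.ext hmem]
    exact hV.preimage (by fun_prop)
  have hm : MapsTo θ (f '' I) I := by
    rintro _ ⟨t, ht, rfl⟩
    rw [hθf t ht]; exact ht
  have hfθ : ∀ s ∈ f '' I, f (θ s) = s := by
    rintro _ ⟨t, ht, rfl⟩
    rw [hθf t ht]
  have hθs : ContDiffOn ℝ ∞ θ (f '' I) :=
    hΘ.comp (f := fun s : ℝ => ((0 : ℝ), s)) (by fun_prop) fun s hs => (hmem s).1 hs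
  have hθd : ∀ s ∈ f '' I, DifferentiableAt ℝ θ s := fun s hs =>
    (hθs.contDiffAt (hopen.mem_nhds hs)).differentiableAt (by simp)
  have hθ0 : ∀ s ∈ f '' I, 0 < deriv θ s := fun s hs => by
    rw [deriv_eq_of_leftInverse hopen hfd one_pos hm hθd hfθ hs]
    exact mul_pos (by simp) (Real.exp_pos _)
  have hf0 : f t₀ = 0 := projectiveParameter_self 0
  refine ⟨f '' I, θ, ⟨hopen, ?_, hθs, hθ0, ?_⟩, ⟨t₀, ht₀, hf0⟩, ?_, ?_⟩
  · exact (hI'.isPreconnected.image f fun t ht =>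
      (hfd t ht).continuousAt.continuousWithinAt).ordConnected
  · rw [image_image]
    exact (image_congr hθf).trans (image_id _)
  · rw [← hf0, hθf t₀ ht₀]
  · exact hc.comp hS hS' hP1 hP2 hI hopen hm hθs hθ0 fun s hs =>
      deriv_deriv_eq_of_leftInverse (p := fun t => p (0, t)) hopen
        (fun t ht => hasDerivAt_integral_slice hI hI' hp ht₀ (mem_univ 0) ht) hfd one_pos hm hθd
        hfθ hs

end Existence

/-! ### Transfer of conjugate points between the two sprays. -/

section Conjugacy

open Filter Topology

variable {E : Type*} [NormedAddCommGroup E] [NormedSpace ℝ E]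
  {M : Type*} [TopologicalSpace M] [ChartedSpace E M] [IsManifold 𝓘(ℝ, E) ∞ M]
  {S S' : (v : TangentBundle 𝓘(ℝ, E) M) → TangentSpace 𝓘(ℝ, E).tangent v}

/-- Conjugacy in terms of families of geodesics, without mention of the variation field. -/
theorem areConjugate_iff {c : ℝ → M} {I : Set ℝ} {t₀ t₁ : ℝ} :
    AreConjugate S c I t₀ t₁ ↔ t₀ ≠ t₁ ∧ ∃ I' ⊆ I, IsOpen I' ∧ I'.OrdConnected ∧ t₀ ∈ I' ∧
      t₁ ∈ I' ∧ ∃ ε : ℝ, 0 < ε ∧ ∃ γ : ℝ → ℝ → M,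
        ContMDiffOn 𝓘(ℝ, ℝ × ℝ) 𝓘(ℝ, E) ∞ (fun p : ℝ × ℝ => γ p.1 p.2) (Ioo (-ε) ε ×ˢ I') ∧
        (∀ u ∈ Ioo (-ε) ε, IsGeodesicOn S (γ u) I') ∧ (∀ t ∈ I', γ 0 t = c t) ∧
        velocity (fun u => γ u t₀) 0 ∉ slit E M ∧ velocity (fun u => γ u t₁) 0 ∉ slit E M ∧
        ∃ t ∈ I', velocity (fun u => γ u t) 0 ∈ slit E M := by
  constructor
  · rintro ⟨hne, I', hsub, ho, hoc, h0, h1, J, ⟨ε, hε, γ, hγ, hgeo, hJ⟩, hJ0, hJ1, t, ht, hJt⟩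
    have key : ∀ t ∈ I', (velocity (fun u => γ u t) 0 ∈ slit E M ↔ J t ≠ 0) := fun t ht => by
      rw [hJ t ht]; rfl
    refine ⟨hne, I', hsub, ho, hoc, h0, h1, ε, hε, γ, hγ, hgeo, fun t ht =>
      congrArg Bundle.TotalSpace.proj (hJ t ht), ?_, ?_, t, ht, (key t ht).2 hJt⟩
    · rw [key _ h0, not_not]; exact hJ0
    · rw [key _ h1, not_not]; exact hJ1
  · rintro ⟨hne, I', hsub, ho, hoc, h0, h1, ε, hε, γ, hγ, hgeo, hc, hv0, hv1, t, ht, hvt⟩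
    let J : (t : ℝ) → TangentSpace 𝓘(ℝ, E) (c t) := fun t =>
      (mfderiv 𝓘(ℝ, ℝ) 𝓘(ℝ, E) (fun u => γ u t) 0 (1 : ℝ) : E)
    have key : ∀ (x y : M), x = y → ∀ X : E, (⟨x, X⟩ : TangentBundle 𝓘(ℝ, E) M) = ⟨y, X⟩ := by
      rintro x y rfl X; rfl
    exact ⟨hne, I', hsub, ho, hoc, h0, h1, J, ⟨ε, hε, γ, hγ, hgeo, fun t ht =>
      key _ _ (hc t ht) _⟩, not_not.1 hv0, not_not.1 hv1, t, ht, hvt⟩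

variable [FiniteDimensional ℝ E]

/-- The variation field of a family of geodesics, reparametrized with fixed values of the new
parameter at two points, does not vanish identically unless the original one does. -/
theorem exists_mem_slit_of_reparametrized_family (hS : IsSpray S) {γ : ℝ → ℝ → M} {U I : Set ℝ}
    (hU : IsOpen U) (h0U : (0 : ℝ) ∈ U) (hI : IsOpen I) (hI' : I.OrdConnected)
    (hγ : ContMDiffOn 𝓘(ℝ, ℝ × ℝ) 𝓘(ℝ, E) ∞ (fun q : ℝ × ℝ => γ q.1 q.2) (U ×ˢ I))
    (hgeo : ∀ u ∈ U, IsGeodesicOn S (γ u) I)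
    {F Θ : ℝ × ℝ → ℝ} (hF : ContDiffOn ℝ ∞ F (U ×ˢ I)) (hF' : StrictMonoOn (fun t => F (0, t)) I)
    {J : Set ℝ} (hJ : IsOpen J) (hJ' : J.OrdConnected)
    (hΘ : ∀ s ∈ J, ContDiffAt ℝ ∞ Θ (0, s)) (hΘF : ∀ q ∈ U ×ˢ I, Θ (q.1, F q) = q.2)
    {t₀ t₁ s₀ s₁ : ℝ} (ht₀ : t₀ ∈ I) (ht₁ : t₁ ∈ I) (ht : t₀ ≠ t₁) (hs₀ : s₀ ∈ J) (hs₁ : s₁ ∈ J)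
    (hb : ∀ u ∈ U, F (u, t₀) = s₀ ∧ F (u, t₁) = s₁)
    (hne : ∃ t ∈ I, velocity (fun u => γ u t) 0 ∈ slit E M) :
    ∃ s ∈ J, velocity (fun u => γ u (Θ (u, s))) 0 ∈ slit E M := by
  by_contra! hcon
  have hUI := hU.prod hI
  have hUn := hU.mem_nhds h0U
  -- The old parameters `t` whose new value along the central geodesic lies in `J`.
  let K : Set ℝ := I ∩ (fun t => F (0, t)) ⁻¹' J
  have hFs : ContDiffOn ℝ ∞ (fun t => F (0, t)) I :=
    hF.comp (f := fun t : ℝ => ((0 : ℝ), t)) (by fun_prop) fun t ht => ⟨h0U, ht⟩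
  have hK : IsOpen K := hFs.continuousOn.isOpen_inter_preimage hI hJ
  have hK' : K.OrdConnected := by
    refine ⟨fun x hx y hy z hz => ?_⟩
    have hzI := hI'.out hx.1 hy.1 hz
    exact ⟨hzI, hJ'.out hx.2 hy.2 ⟨hF'.monotoneOn hx.1 hzI hz.1, hF'.monotoneOn hzI hy.1 hz.2⟩⟩
  have h0K : t₀ ∈ K := ⟨ht₀, by rw [mem_preimage, (hb 0 h0U).1]; exact hs₀⟩
  have h1K : t₁ ∈ K := ⟨ht₁, by rw [mem_preimage, (hb 0 h0U).2]; exact hs₁⟩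
  -- The new variation field is the old one plus `∂_uΘ · ċ`; if it vanishes, the old field is `g •
  -- ċ` with `g = -∂_uΘ`.
  let g : ℝ → ℝ := fun t => -fderiv ℝ Θ (0, F (0, t)) (1, 0)
  have hg : ∀ t ∈ K, ContDiffAt ℝ ∞ g t := by
    intro t ht
    have h1 : ContDiffAt ℝ ∞ (fun t => ((0 : ℝ), F (0, t))) t :=
      contDiffAt_const.prodMk (hFs.contDiffAt (hI.mem_nhds ht.1))
    exact (ContDiffAt.comp (g := fun q => fderiv ℝ Θ q (1, 0)) t
      ((hΘ _ ht.2).fderiv_apply_const (1, 0)) h1).neg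
  have htan : ∀ t ∈ K, ∀ p : M, γ 0 t ∈ (chartAt E p).source →
      fderiv ℝ (fun q : ℝ × ℝ => extChartAt 𝓘(ℝ, E) p (γ q.1 q.2)) (0, t) (1, 0) =
        g t • fderiv ℝ (fun q : ℝ × ℝ => extChartAt 𝓘(ℝ, E) p (γ q.1 q.2)) (0, t) (0, 1) := by
    intro t ht p hp
    have hq : ((0 : ℝ), t) ∈ U ×ˢ I := ⟨h0U, ht.1⟩
    have hΘt : Θ (0, F (0, t)) = t := hΘF (0, t) hq
    have hγd := hγ.contMDiffAt (hUI.mem_nhds hq)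
    have hX := (contDiffAt_coordFamily hγd hp).differentiableAt (by simp)
    set X : ℝ × ℝ → E := fun q => extChartAt 𝓘(ℝ, E) p (γ q.1 q.2) with hXdef
    have hΘd := hasDerivAt_slice_fst ((hΘ _ ht.2).differentiableAt (by simp))
    have hpath : HasDerivAt (fun u => (u, Θ (u, F (0, t))))
        ((1 : ℝ), fderiv ℝ Θ (0, F (0, t)) (1, 0)) 0 := (hasDerivAt_id _).prodMk hΘd
    have hX' : HasFDerivAt X (fderiv ℝ X (0, t)) (0, Θ (0, F (0, t))) := by
      rw [hΘt]; exact hX.hasFDerivAt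
    have h1 := hX'.comp_hasDerivAt (0 : ℝ) hpath
    have hsm : ContMDiffAt 𝓘(ℝ, ℝ) 𝓘(ℝ, E) ∞ (fun u => γ u (Θ (u, F (0, t)))) 0 := by
      refine ContMDiffAt.comp (I' := 𝓘(ℝ, ℝ × ℝ)) (g := fun q : ℝ × ℝ => γ q.1 q.2)
        (f := fun u : ℝ => (u, Θ (u, F (0, t)))) 0 ?_ (ContDiffAt.contMDiffAt ?_)
      · rw [hΘt]; exact hγd
      · exact contDiffAt_id.prodMk (ContDiffAt.comp (g := Θ) (f := fun u : ℝ => (u, F (0, t))) 0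
          (hΘ _ ht.2) (by fun_prop))
    have hp' : γ 0 (Θ (0, F (0, t))) ∈ (chartAt E p).source := by rw [hΘt]; exact hp
    have h2 := hcon _ ht.2
    rw [mem_slit_iff (p := p) (v := velocity (fun u => γ u (Θ (u, F (0, t)))) 0) hp', not_not,
      tangentChart_velocity (hsm.mdifferentiableAt (by simp)) hp'] at h2
    have h3 : fderiv ℝ X (0, t) (1, fderiv ℝ Θ (0, F (0, t)) (1, 0)) = 0 :=
      h1.deriv.symm.trans h2
    have h4 : ((1 : ℝ), fderiv ℝ Θ (0, F (0, t)) (1, 0)) =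
        (1, 0) + fderiv ℝ Θ (0, F (0, t)) (1, 0) • ((0 : ℝ), (1 : ℝ)) := by simp
    rw [h4, map_add, map_smul] at h3
    rw [eq_neg_of_add_eq_zero_left h3, ← neg_smul]
  have hg2 : ∀ t ∈ K, deriv (deriv g) t = 0 := fun t ht =>
    deriv_deriv_eq_zero_of_tangential_family hS hU hI hγ hgeo h0U ht.1 (hg t ht)
      (Filter.eventually_of_mem (hK.mem_nhds ht) htan)
  -- Where `F (u, t)` does not depend on `u`, neither does `Θ` at that value, so `∂_uΘ = 0` there.
  have hend : ∀ t ∈ K, ∀ s, (∀ u ∈ U, F (u, t) = s) → g t = 0 := by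
    intro t ht s hts
    have h1 := hasDerivAt_slice_fst ((hΘ _ ht.2).differentiableAt (by simp))
    have h2 : (fun u => Θ (u, F (0, t))) =ᶠ[𝓝 0] fun _ => t := by
      filter_upwards [hUn] with u hu
      rw [hts 0 h0U, ← hts u hu]
      exact hΘF (u, t) ⟨hu, ht.1⟩
    have h3 := h1.unique ((hasDerivAt_const (0 : ℝ) t).congr_of_eventuallyEq h2)
    simp only [g, h3, neg_zero]
  have hgz : ∀ t ∈ K, g t = 0 := fun t htK =>
    eq_zero_of_deriv_deriv_eq_zero hK hK' hg hg2 h0K h1K ht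
      (hend t₀ h0K s₀ fun u hu => (hb u hu).1) (hend t₁ h1K s₁ fun u hu => (hb u hu).2) htK
  obtain ⟨t, htI, hvt⟩ := hne
  refine velocity_notMem_slit_of_eventually hS hU hI hI' hγ hgeo h0U ht₀ ?_ htI hvt
  filter_upwards [hK.mem_nhds h0K] with τ hτ
  rw [velocity_slice_fst_mem_slit_iff (q := ((0 : ℝ), τ)) (p := γ 0 τ)
    (hγ.contMDiffAt (hUI.mem_nhds ⟨h0U, hτ.1⟩)) (mem_chart_source E _), not_not,
    htan τ hτ _ (mem_chart_source E _), hgz τ hτ, zero_smul]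

/-- Each geodesic of the family gets its own new parameter, normalized to `s₀` and `s₁` at the two
conjugate points. This normalization keeps the variation field zero at both ends. -/
theorem AreConjugate.of_projectivelyRelated (hS : IsSpray S) (hS' : IsSpray S')
    (h : ProjectivelyRelated S S') {c c' : ℝ → M} {I I' : Set ℝ} (hI : IsOpen I)
    (hc : IsGeodesicOn S c I) (hc' : IsGeodesicOn S' c' I') {θ : ℝ → ℝ}
    (hθ : IsReparametrization θ I' I) (hcc' : EqOn c' (c ∘ θ) I') {s₀ s₁ : ℝ} (hs₀ : s₀ ∈ I')
    (hs₁ : s₁ ∈ I') (hconj : AreConjugate S c I (θ s₀) (θ s₁)) : AreConjugate S' c' I' s₀ s₁ := by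
  obtain ⟨P, hP, hP1, hP2⟩ := h
  rw [areConjugate_iff] at hconj ⊢
  obtain ⟨hne, I₁, hsub, hI₁, hI₁', ht₀, ht₁, ε, hε, γ, hγ, hgeo, hγc, hv₀, hv₁, hv⟩ := hconj
  have hne' : s₀ ≠ s₁ := fun h => hne (by rw [h])
  have hm : MapsTo θ I' I := fun s hs => by rw [← hθ.image_eq]; exact mem_image_of_mem θ hs
  have hmono := hθ.strictMonoOn
  have hU : IsOpen (Ioo (-ε) ε) := isOpen_Ioo
  have h0U : (0 : ℝ) ∈ Ioo (-ε) ε := ⟨by linarith, hε⟩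
  set U := Ioo (-ε) ε with hUdef
  let p : ℝ × ℝ → ℝ := fun q => P (velocity (γ q.1) q.2)
  have hp : ContDiffOn ℝ ∞ p (U ×ˢ I₁) :=
    contDiffOn_comp_velocity hU hI₁ hγ (fun q hq => (hgeo _ hq.1).regular _ hq.2) hP
  have hord : s₀ < s₁ ∧ θ s₀ < θ s₁ ∨ s₁ < s₀ ∧ θ s₁ < θ s₀ := by
    rcases lt_or_gt_of_ne hne' with h | h
    · exact Or.inl ⟨h, hmono hs₀ hs₁ h⟩
    · exact Or.inr ⟨h, hmono hs₁ hs₀ h⟩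
  obtain ⟨F, hF, hF0, hFb, hFd⟩ := exists_projectiveParameter_of_boundary hU hI₁ hI₁' hp ht₀ ht₁
    hord
  obtain ⟨Θ, hV, hΘ, hΘF⟩ := exists_contDiffOn_inverse_family hU hI₁ hI₁' hF hF0
  set V := (fun q : ℝ × ℝ => (q.1, F q)) '' (U ×ˢ I₁) with hVdef
  have hΘV : ∀ u s, (u, s) ∈ V → Θ (u, s) ∈ I₁ ∧ F (u, Θ (u, s)) = s := by
    rintro u s ⟨⟨u', t⟩, hq, hqe⟩
    obtain ⟨rfl, rfl⟩ := Prod.mk.inj hqe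
    rw [hΘF _ hq]
    exact ⟨hq.2, rfl⟩
  have hF0c : ContinuousOn (fun t => F (0, t)) I₁ :=
    hF.continuousOn.comp (f := fun t : ℝ => ((0 : ℝ), t)) (by fun_prop) fun t ht => ⟨h0U, ht⟩
  -- By the intermediate value theorem `F (0, ·)` takes every value between `s₀` and `s₁`.
  have hsegV : ({0} : Set ℝ) ×ˢ uIcc s₀ s₁ ⊆ V := by
    rintro ⟨u, s⟩ ⟨hu, hs⟩
    rw [mem_singleton_iff] at hu
    simp only at hu hs
    subst hu
    have h1 := intermediate_value_uIcc (hF0c.mono (hI₁'.uIcc_subset ht₀ ht₁))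
    rw [(hFb 0 h0U).1, (hFb 0 h0U).2] at h1
    obtain ⟨t, ht, hts⟩ := h1 hs
    exact ⟨(0, t), ⟨h0U, hI₁'.uIcc_subset ht₀ ht₁ ht⟩, by simp only [hts]⟩
  -- The new parameter intervals vary with `u`; compactness of the segment gives a common interval
  -- for all small `u`.
  obtain ⟨A, B, hA, hB, h0A, hsB, hAB⟩ := generalized_tube_lemma isCompact_singleton
    isCompact_uIcc hV hsegV
  have hs₀B : s₀ ∈ B := hsB left_mem_uIcc
  -- The set `B` need not be an interval, so the component containing the segment is taken.
  let J := connectedComponentIn B s₀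
  have hJ : IsOpen J := hB.connectedComponentIn
  have hJ' : J.OrdConnected := isPreconnected_connectedComponentIn.ordConnected
  have hsJ : uIcc s₀ s₁ ⊆ J :=
    isPreconnected_uIcc.subset_connectedComponentIn left_mem_uIcc hsB
  have hJB : J ⊆ B := connectedComponentIn_subset _ _
  obtain ⟨ε', hε', hball⟩ := Metric.isOpen_iff.1 (hA.inter hU) 0 ⟨h0A rfl, h0U⟩
  rw [Real.ball_eq_Ioo, zero_sub, zero_add] at hball
  have h0ε : (0 : ℝ) ∈ Ioo (-ε') ε' := ⟨by linarith, hε'⟩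
  have hUJ : ∀ u ∈ Ioo (-ε') ε', ∀ s ∈ J, (u, s) ∈ V := fun u hu s hs =>
    hAB ⟨(hball hu).1, hJB hs⟩
  have hγ0 : ∀ t ∈ I₁, (velocity (γ 0) t : TangentBundle 𝓘(ℝ, E) M) = velocity c t := fun t ht =>
    velocity_congr (Filter.eventually_of_mem (hI₁.mem_nhds ht) hγc)
  -- along the central geodesic the new parameter is the given one
  have hcentral : ∀ s ∈ J, s ∈ I' ∧ Θ (0, s) = θ s := by
    intro s hs
    obtain ⟨hΘI, hFΘ⟩ := hΘV 0 s (hUJ 0 h0ε s hs)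
    have h1 := hsub hΘI
    rw [← hθ.image_eq] at h1
    obtain ⟨s', hs', hθs'⟩ := h1
    obtain ⟨k, hk, hFk⟩ := hFd 0 h0U
    -- On `L`, an interval containing `s₀` and `s₁`, both `θ` and `F (0, ·)` are available. Boundary
    -- value uniqueness gives `F (0, θ s') = s'`, and `θ s' = Θ (0, s)` then forces `s' = s`.
    let L : Set ℝ := I' ∩ θ ⁻¹' I₁
    have hL : IsOpen L := hθ.smooth.continuousOn.isOpen_inter_preimage hθ.isOpen hI₁
    have hL' : L.OrdConnected := by
      refine ⟨fun x hx y hy z hz => ?_⟩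
      have hzI := hθ.ordConnected.out hx.1 hy.1 hz
      exact ⟨hzI, hI₁'.out hx.2 hy.2
        ⟨hmono.monotoneOn hx.1 hzI hz.1, hmono.monotoneOn hzI hy.1 hz.2⟩⟩
    have h2 : F (0, θ s') = s' := leftInverse_of_deriv_deriv_eq (p := fun t => p (0, t))
      (f := fun t => F (0, t)) hL hL'
      (fun t ht => hasDerivAt_integral_slice hI₁ hI₁' hp ht₀ h0U ht) hFk (fun s hs => hs.2)
      (hθ.smooth.mono inter_subset_left)
      (fun s hs => by
        simp only [p]
        rw [hγ0 _ hs.2]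
        exact hc.deriv_deriv_of_comp hS hS' hP1 hP2 hI hθ.isOpen hc' hcc' hm hθ.smooth
          hθ.deriv_pos hs.1)
      (s₀ := s₀) (s₁ := s₁) ⟨hs₀, ht₀⟩ ⟨hs₁, ht₁⟩ hne' (hFb 0 h0U).1 (hFb 0 h0U).2
      ⟨hs', by rw [mem_preimage, hθs']; exact hΘI⟩
    rw [hθs', hFΘ] at h2
    subst h2
    exact ⟨hs', hθs'.symm⟩
  have hΘu : ∀ u ∈ Ioo (-ε') ε', ContDiffOn ℝ ∞ (fun s => Θ (u, s)) J := fun u hu =>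
    hΘ.comp (f := fun s : ℝ => (u, s)) (by fun_prop) fun s hs => hUJ u hu s hs
  have hstart : ∀ u ∈ Ioo (-ε') ε', Θ (u, s₀) = θ s₀ ∧ Θ (u, s₁) = θ s₁ := fun u hu => by
    have h1 := hFb u (hball hu).2
    have h2 := hΘF (u, θ s₀) ⟨(hball hu).2, ht₀⟩
    have h3 := hΘF (u, θ s₁) ⟨(hball hu).2, ht₁⟩
    rw [h1.1] at h2
    rw [h1.2] at h3
    exact ⟨h2, h3⟩
  have hεn : Ioo (-ε') ε' ∈ 𝓝 (0 : ℝ) := Ioo_mem_nhds h0ε.1 h0ε.2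
  refine ⟨hne', J, fun s hs => (hcentral s hs).1, hJ, hJ', hsJ left_mem_uIcc, hsJ right_mem_uIcc,
    ε', hε', fun u s => γ u (Θ (u, s)), ?_, ?_, ?_, ?_, ?_, ?_⟩
  · refine hγ.comp (I' := 𝓘(ℝ, ℝ × ℝ)) (g := fun q : ℝ × ℝ => γ q.1 q.2)
      (f := fun q : ℝ × ℝ => (q.1, Θ q)) (ContDiffOn.contMDiffOn ?_) ?_
    · exact contDiffOn_fst.prodMk (hΘ.mono fun q hq => hUJ _ hq.1 _ hq.2)
    · exact fun q hq => ⟨(hball hq.1).2, (hΘV _ _ (hUJ _ hq.1 _ hq.2)).1⟩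
  · intro u hu
    obtain ⟨k, hk, hFk⟩ := hFd u (hball hu).2
    have hmu : MapsTo (fun s => Θ (u, s)) J I₁ := fun s hs => (hΘV _ _ (hUJ u hu s hs)).1
    have hdu : ∀ s ∈ J, DifferentiableAt ℝ (fun s => Θ (u, s)) s := fun s hs =>
      ((hΘu u hu).contDiffAt (hJ.mem_nhds hs)).differentiableAt (by simp)
    have hinv : ∀ s ∈ J, F (u, Θ (u, s)) = s := fun s hs => (hΘV _ _ (hUJ u hu s hs)).2
    refine (hgeo u (hball hu).2).comp hS hS' hP1 hP2 hI₁ hJ hmu (hΘu u hu) (fun s hs => ?_)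
      fun s hs => deriv_deriv_eq_of_leftInverse (p := fun t => p (u, t)) (f := fun t => F (u, t)) hJ
        (fun t ht => hasDerivAt_integral_slice hI₁ hI₁' hp ht₀ (hball hu).2 ht) hFk hk hmu hdu
        hinv hs
    rw [deriv_eq_of_leftInverse (f := fun t => F (u, t)) hJ hFk hk hmu hdu hinv hs]
    exact mul_pos (inv_pos.2 hk) (Real.exp_pos _)
  · intro s hs
    obtain ⟨hsI, hΘs⟩ := hcentral s hs
    rw [hcc' hsI]
    change γ 0 (Θ (0, s)) = c (θ s)
    rw [hγc _ (hΘV _ _ (hUJ 0 h0ε s hs)).1, hΘs]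
  -- For small `u` one has `Θ (u, s₀) = θ s₀`, so at this end the transverse curve, and with it the
  -- variation vector, is unchanged.
  · rwa [velocity_congr (c' := fun u => γ u (θ s₀))
      (Filter.eventually_of_mem hεn fun u hu => by simp only [(hstart u hu).1])]
  · rwa [velocity_congr (c' := fun u => γ u (θ s₁))
      (Filter.eventually_of_mem hεn fun u hu => by simp only [(hstart u hu).2])]
  · exact exists_mem_slit_of_reparametrized_family hS hU h0U hI₁ hI₁' hγ hgeo hF
      (strictMonoOn_of_fderiv_pos hU hI₁ hI₁' hF hF0 h0U) hJ hJ'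
      (fun s hs => hΘ.contDiffAt (hV.mem_nhds (hUJ 0 h0ε s hs))) hΘF ht₀ ht₁ hne
      (hsJ left_mem_uIcc) (hsJ right_mem_uIcc) hFb hv

end Conjugacy

end SprayGeometry

end

theorem theorem3p6 {E : Type*} [NormedAddCommGroup E] [NormedSpace ℝ E] [FiniteDimensional ℝ E]
    {M : Type*} [TopologicalSpace M] [T2Space M] [ChartedSpace E M] [IsManifold 𝓘(ℝ, E) ∞ M]
    (S S' : (v : TangentBundle 𝓘(ℝ, E) M) → TangentSpace 𝓘(ℝ, E).tangent v)
    (hS : SprayGeometry.IsSpray S) (hS' : SprayGeometry.IsSpray S')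
    (hSS' : SprayGeometry.ProjectivelyRelated S S')
    (c : ℝ → M) (I : Set ℝ) (hI : IsOpen I) (hI' : I.OrdConnected)
    (hc : SprayGeometry.IsGeodesicOn S c I) :
    (∀ t₀ ∈ I, ∃ (I' : Set ℝ) (θ : ℝ → ℝ), SprayGeometry.IsReparametrization θ I' I ∧
      0 ∈ I' ∧ θ 0 = t₀ ∧ SprayGeometry.IsGeodesicOn S' (c ∘ θ) I') ∧
    ∀ (I' : Set ℝ) (θ : ℝ → ℝ), SprayGeometry.IsReparametrization θ I' I →
      SprayGeometry.IsGeodesicOn S' (c ∘ θ) I' →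
      ∀ s₀ ∈ I', ∀ s₁ ∈ I',
        (SprayGeometry.AreConjugate S c I (θ s₀) (θ s₁) ↔
          SprayGeometry.AreConjugate S' (c ∘ θ) I' s₀ s₁) := by
  refine ⟨fun t₀ ht₀ => hSS'.exists_isReparametrization hS hS' hI hI' hc ht₀,
    fun I' θ hθ hc' s₀ hs₀ s₁ hs₁ => ⟨fun h => ?_, fun h => ?_⟩⟩
  · exact h.of_projectivelyRelated hS hS' hSS' hI hc hc' hθ (Set.eqOn_refl _ _) hs₀ hs₁
  -- The same transfer from `S'` to `S` along the inverse `η` of `θ`; here `c` equals `(c ∘ θ) ∘ η`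
  -- on `I`, and its values elsewhere play no role.
  · obtain ⟨η, hη, hηθ⟩ := hθ.exists_inverse hI hI'
    have hm : ∀ s ∈ I', θ s ∈ I := fun s hs => hθ.image_eq ▸ Set.mem_image_of_mem θ hs
    have hcη : Set.EqOn c ((c ∘ θ) ∘ η) I := by
      intro t ht
      rw [← hθ.image_eq] at ht
      obtain ⟨s, hs, rfl⟩ := ht
      simp only [Function.comp, hηθ s hs]
    rw [← hηθ s₀ hs₀, ← hηθ s₁ hs₁] at h
    exact h.of_projectivelyRelated hS' hS hSS'.symm hθ.isOpen hc' hc hη hcη (hm s₀ hs₀) (hm s₁ hs₁)
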